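/- **Setting.** Let $\mathcal T_0$ be a finite conforming triangulation of (the closure of) a polygonal domain $\Omega\subset\mathbb R^2$ into compact nondegenerate triangles. Each triangle has a marked refinement edge, and these are chosen such that the matching condition holds: an edge shared by two triangles of $\mathcal T_0$ is the refinement edge of either both or neither of them. For a conforming triangulation $\mathcal T$, let $\mathrm{refine}(\mathcal T)$ be the set of all conforming triangulations generated from $\mathcal T$ by finitely many newest vertex bisections, and let $\mathbb T:=\mathrm{refine}(\mathcal T_0)$. For $T\in\mathcal T\in\mathbb T$, $\mathrm{level}(T)$ is the number of bisections that generate $T$ from an element of $\mathcal T_0$. Put $\omega(T,\mathcal T):=\{T'\in\mathcal T: T\cap T'\ne\emptyset\}$, and for $S\subseteq\mathbb R^2$ put $\omega(S,\mathcal T):=\{T\in\mathcal T: (\bigcup\omega(T,\mathcal T))^\circ\cap S\neq\emptyset\}$, $\omega^1(S,\mathcal T):=\omega(S,\mathcal T)$, $\omega^k(S,\mathcal T):=\omega(\bigcup\omega^{k-1}(S,\mathcal T),\mathcal T)$ for $k\ge2$. Fix $D_{\rm grad}\in\mathbb N$, $D_{\rm grad}\ge1$, and let $\mathbb T_{\rm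 grad}$ be the set of all mildly graded $\mathcal T\in\mathbb T$, that is, those with $$|\mathrm{level}(T)-\mathrm{level}(T')|\le 1\quad\text{for all }T\in\mathcal T,\ T'\in\omega^{D_{\rm grad}}(T,\mathcal T).$$ Let $\mathcal X$ be a real Hilbert space, $a:\mathcal X\times\mathcal X\to\mathbb R$ a bounded elliptic bilinear form, and $\mathcal X_{\mathcal T}\subseteq\mathcal X$ a closed subspace for each $\mathcal T\in\mathbb T$. For $f\in\mathcal X^*$ let $u\in\mathcal X$ and $u_{\mathcal T}\in\mathcal X_{\mathcal T}$ be the unique solutions of $a(u,v)=f(v)$ for all $v\in\mathcal X$ and $a(u_{\mathcal T},v)=f(v)$ for all $v\in\mathcal X_{\mathcal T}$. Let $F\subseteq\mathcal X^*$ be a set of data (for example a single $f$), and for each $f\in F$ let real numbers $\eta_T(\mathcal T)$ ($T\in\mathcal T\in\mathbb T$) be given, which may depend on $f$, with the error estimator $\eta(\mathcal T):=\big(\sum_{T\in\mathcal T}\eta_T(\mathcal T)^2\big)^{1/2}$. **Assumptions.** For every $f\in F$ there are constants $C_{\rm stab},C_{\rm red},C_{\rm dlr},C_{\rm ref}>0$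 and $0\le q_{\rm red}<1$ such that for all $\mathcal T,\widehat{\mathcal T}\in\mathbb T$ with $\widehat{\mathcal T}\in\mathrm{refine}(\mathcal T)$: * (A1) for all $\mathcal S\subseteq\mathcal T\cap\widehat{\mathcal T}$, $$\Big|\Big(\sum_{T\in\mathcal S}\eta_T(\widehat{\mathcal T})^2\Big)^{1/2}-\Big(\sum_{T\in\mathcal S}\eta_T(\mathcal T)^2\Big)^{1/2}\Big|\le C_{\rm stab}\|u_{\mathcal T}-u_{\widehat{\mathcal T}}\|_{\mathcal X};$$ * (A2) $$\sum_{T\in\widehat{\mathcal T}\setminus\mathcal T}\eta_T(\widehat{\mathcal T})^2\le q_{\rm red}\sum_{T\in\mathcal T\setminus\widehat{\mathcal T}}\eta_T(\mathcal T)^2+C_{\rm red}\|u_{\mathcal T}-u_{\widehat{\mathcal T}}\|_{\mathcal X}^2;$$ * (A4) there is a set $\mathcal R$ with $\mathcal T\setminus\widehat{\mathcal T}\subseteq\mathcal R\subseteq\mathcal T$ and $\#\mathcal R\le C_{\rm ref}\,\#(\mathcal T\setminus\widehat{\mathcal T})$ such that $$\|u_{\widehat{\mathcal T}}-u_{\mathcal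 T}\|_{\mathcal X}^2\le C_{\rm dlr}^2\sum_{T\in\mathcal R}\eta_T(\mathcal T)^2.$$ **Claim.** For $s>0$ let $\mathbb A_s$ be the set of the exact solutions $u$ for data $f\in F$ with $$\sup_{N\in\mathbb N}\ \min_{\mathcal T\in\mathbb T,\ \#\mathcal T-\#\mathcal T_0\le N}N^s\eta(\mathcal T)<\infty ,$$ and let $\mathbb A_s^{\rm grad}$ be defined in the same way with $\mathbb T_{\rm grad}$ in place of $\mathbb T$. Then $\mathbb A_s=\mathbb A_s^{\rm grad}$ for every $s>0$. -/

import Mathlib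

open scoped ENNReal

noncomputable section

namespace AFEM

/-! ### Triangles and newest vertex bisection -/

/-- The Euclidean plane. -/
abbrev Plane : Type := EuclideanSpace ℝ (Fin 2)

/-- An element of a triangulation: a triangle with a distinguished newest vertex `apex` (its
refinement edge is the opposite edge, from `left` to `right`) and the number `level` of bisections
by which it was generated from an element of the initial triangulation. -/
@[ext]
structure Elem where
  apex : Plane
  left : Plane
  right : Plane
  level : ℕ

instance : DecidableEq Elem := Classical.decEq Elem

namespace Elem

/-- The set of vertices. -/
def verts (T : Elem) : Set Plane := {T.apex, T.left, T.right}

/-- The compact triangle itself. -/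
def carrier (T : Elem) : Set Plane := convexHull ℝ T.verts

/-- The refinement edge, given by its two endpoints. -/
def refEdge (T : Elem) : Set Plane := {T.left, T.right}

/-- The three vertices are not collinear. -/
def Nondegenerate (T : Elem) : Prop := AffineIndependent ℝ ![T.apex, T.left, T.right]

/-- First son of `T` under newest vertex bisection: the midpoint of the refinement edge
becomes the newest vertex. -/
def son₁ (T : Elem) : Elem := ⟨midpoint ℝ T.left T.right, T.apex, T.left, T.level + 1⟩

/-- Second son of `T` under newest vertex bisection. -/
def son₂ (T : Elem) : Elem := ⟨midpoint ℝ T.left T.right, T.apex, T.right, T.level + 1⟩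

end Elem

/-- A finite collection of elements. -/
abbrev Mesh : Type := Finset Elem

/-- Conformity (no hanging nodes, no overlaps): two different elements have different vertex sets
and they intersect in the convex hull of their common vertices, that is, in the empty set, in a
common vertex, or in a common edge. -/
def IsConforming (𝒯 : Mesh) : Prop :=
  ∀ T ∈ 𝒯, ∀ T' ∈ 𝒯, T ≠ T' →
    T.verts ≠ T'.verts ∧ T.carrier ∩ T'.carrier = convexHull ℝ (T.verts ∩ T'.verts)

/-- `𝒯₀` is an initial triangulation of `Ω`: a conforming triangulation of the closure of `Ω` into
finitely many nondegenerate compact triangles (with arbitrarily chosen refinement edges), all of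
which have level zero. -/
structure IsInitialTriangulation (Ω : Set Plane) (𝒯₀ : Mesh) : Prop where
  nondegenerate : ∀ T ∈ 𝒯₀, T.Nondegenerate
  conforming : IsConforming 𝒯₀
  covers : ⋃ T ∈ 𝒯₀, T.carrier = closure Ω
  level_eq_zero : ∀ T ∈ 𝒯₀, T.level = 0

/-- The matching condition on the choice of the refinement edges in the initial triangulation:
if the refinement edge of `T` is also an edge of `T'`, then it is the refinement edge of `T'`. -/
def HasMatchingRefEdges (𝒯₀ : Mesh) : Prop :=
  ∀ T ∈ 𝒯₀, ∀ T' ∈ 𝒯₀, T.refEdge ⊆ T'.verts → T.refEdge = T'.refEdge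

/-- One single bisection: an element is replaced by its two sons. -/
def BisectStep (𝒯 𝒯' : Mesh) : Prop :=
  ∃ T ∈ 𝒯, 𝒯' = 𝒯.erase T ∪ {T.son₁, T.son₂}

/-- `refine 𝒯`: the conforming triangulations which are generated from `𝒯` by finitely many
newest vertex bisections. -/
def refinements (𝒯 : Mesh) : Set Mesh :=
  {𝒯' | Relation.ReflTransGen BisectStep 𝒯 𝒯' ∧ IsConforming 𝒯'}

/-! ### Patches and mild grading -/

/-- The patch `ω(T, 𝒯)` of an element. -/
def elemPatch (𝒯 : Mesh) (T : Elem) : Set Elem :=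
  {T' | T' ∈ 𝒯 ∧ (T.carrier ∩ T'.carrier).Nonempty}

/-- The patch `ω(S, 𝒯)` of a set of points. -/
def patch (𝒯 : Mesh) (S : Set Plane) : Set Elem :=
  {T | T ∈ 𝒯 ∧ (interior (⋃ T' ∈ elemPatch 𝒯 T, T'.carrier) ∩ S).Nonempty}

/-- The extended patches `ω^k(S, 𝒯)` for `k ≥ 1` (with the unused value `∅` for `k = 0`). -/
def extPatch (𝒯 : Mesh) (S : Set Plane) : ℕ → Set Elem
  | 0 => ∅
  | 1 => patch 𝒯 S
  | k + 2 => patch 𝒯 (⋃ T ∈ extPatch 𝒯 S (k + 1), T.carrier)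

/-- Mild grading with parameter `D`: the levels of the elements in `ω^D(T, 𝒯)` differ from the
level of `T` by at most one. -/
def IsGraded (D : ℕ) (𝒯 : Mesh) : Prop :=
  ∀ T ∈ 𝒯, ∀ T' ∈ extPatch 𝒯 T.carrier D, |(T.level : ℤ) - (T'.level : ℤ)| ≤ 1

/-- The mildly graded triangulations among all refinements of `𝒯₀`. -/
def gradedRefinements (𝒯₀ : Mesh) (D : ℕ) : Set Mesh :=
  {𝒯 | 𝒯 ∈ refinements 𝒯₀ ∧ IsGraded D 𝒯}

/-! ### Galerkin solutions -/

section Galerkin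

variable {X : Type*} [NormedAddCommGroup X] [InnerProductSpace ℝ X] [CompleteSpace X]

/-- Lax-Milgram on a closed subspace. -/
theorem existsUnique_galerkin {a : X →L[ℝ] X →L[ℝ] ℝ} (ha : IsCoercive a)
    (V : ClosedSubmodule ℝ X) (f : X →L[ℝ] ℝ) :
    ∃! w : X, w ∈ V ∧ ∀ v ∈ V, a w v = f v := by
  obtain ⟨c, hc, hac⟩ := ha
  have : CompleteSpace V.toSubmodule := V.isClosed.completeSpace_coe
  let ι : V.toSubmodule →L[ℝ] X := V.toSubmodule.subtypeL
  have hB : IsCoercive (a.bilinearComp ι ι) := ⟨c, hc, fun u => hac u⟩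
  let r : V.toSubmodule := (InnerProductSpace.toDual ℝ V.toSubmodule).symm (f.comp ι)
  obtain ⟨w', hw'⟩ := hB.continuousLinearEquivOfBilin.surjective r
  have key : ∀ v ∈ V, a (w' : X) v = f v := by
    intro v hv
    have h := hB.continuousLinearEquivOfBilin_apply w' ⟨v, hv⟩
    rw [hw'] at h
    have h2 : inner ℝ r (⟨v, hv⟩ : V.toSubmodule) = f v := by simp [r, ι]
    rw [h2] at h
    exact h.symm
  refine ⟨w', ⟨w'.2, key⟩, ?_⟩
  rintro w ⟨hw, hwv⟩
  have hd : w - (w' : X) ∈ V := V.toSubmodule.sub_mem hw w'.2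
  have h0 : a (w - (w' : X)) (w - (w' : X)) = 0 := by
    have e : a (w - (w' : X)) = a w - a (w' : X) := map_sub a _ _
    have e2 : (a w - a (w' : X)) (w - (w' : X)) = a w (w - w') - a (w' : X) (w - w') := rfl
    rw [e, e2, hwv _ hd, key _ hd, sub_self]
  have h1 := hac (w - (w' : X))
  rw [h0] at h1
  have h3 : ‖w - (w' : X)‖ = 0 := by
    by_contra hne
    have : 0 < ‖w - (w' : X)‖ := lt_of_le_of_ne (norm_nonneg _) (Ne.symm hne)
    nlinarith [mul_pos (mul_pos hc this) this]
  exact sub_eq_zero.mp (norm_eq_zero.mp h3)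

/-- The Galerkin solution in the closed subspace `V`: the unique `w ∈ V` with `a w v = f v` for all
`v ∈ V`. -/
def galerkinSolution (a : X →L[ℝ] X →L[ℝ] ℝ) (ha : IsCoercive a) (f : X →L[ℝ] ℝ)
    (V : ClosedSubmodule ℝ X) : X :=
  (existsUnique_galerkin ha V f).choose

theorem galerkinSolution_mem (a : X →L[ℝ] X →L[ℝ] ℝ) (ha : IsCoercive a) (f : X →L[ℝ] ℝ)
    (V : ClosedSubmodule ℝ X) : galerkinSolution a ha f V ∈ V :=
  (existsUnique_galerkin ha V f).choose_spec.1.1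

theorem galerkinSolution_spec (a : X →L[ℝ] X →L[ℝ] ℝ) (ha : IsCoercive a) (f : X →L[ℝ] ℝ)
    (V : ClosedSubmodule ℝ X) : ∀ v ∈ V, a (galerkinSolution a ha f V) v = f v :=
  (existsUnique_galerkin ha V f).choose_spec.1.2

end Galerkin

/-! ### Estimator axioms

Here `uh 𝒯` is the discrete solution on the triangulation `𝒯`, and `η 𝒯 T` is the contribution of
the element `T` to the error estimator on `𝒯`. -/

section Axioms

variable {X : Type*} [NormedAddCommGroup X]

/-- Stability on non-refined elements. -/
def StabilityAxiom (𝒯₀ : Mesh) (uh : Mesh → X) (η : Mesh → Elem → ℝ) : Prop :=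
  ∃ Cstab : ℝ, 0 < Cstab ∧
    ∀ 𝒯 ∈ refinements 𝒯₀, ∀ 𝒯' ∈ refinements 𝒯₀, 𝒯' ∈ refinements 𝒯 →
      ∀ S : Finset Elem, S ⊆ 𝒯 ∩ 𝒯' →
        |√(∑ T ∈ S, η 𝒯' T ^ 2) - √(∑ T ∈ S, η 𝒯 T ^ 2)| ≤ Cstab * ‖uh 𝒯 - uh 𝒯'‖

/-- Reduction on refined elements. -/
def ReductionAxiom (𝒯₀ : Mesh) (uh : Mesh → X) (η : Mesh → Elem → ℝ) : Prop :=
  ∃ q Cred : ℝ, 0 ≤ q ∧ q < 1 ∧ 0 < Cred ∧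
    ∀ 𝒯 ∈ refinements 𝒯₀, ∀ 𝒯' ∈ refinements 𝒯₀, 𝒯' ∈ refinements 𝒯 →
      ∑ T ∈ 𝒯' \ 𝒯, η 𝒯' T ^ 2 ≤ q * ∑ T ∈ 𝒯 \ 𝒯', η 𝒯 T ^ 2 + Cred * ‖uh 𝒯 - uh 𝒯'‖ ^ 2

/-- Discrete reliability. -/
def DiscreteReliabilityAxiom (𝒯₀ : Mesh) (uh : Mesh → X) (η : Mesh → Elem → ℝ) : Prop :=
  ∃ Cdlr Cref : ℝ, 0 < Cdlr ∧ 0 < Cref ∧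
    ∀ 𝒯 ∈ refinements 𝒯₀, ∀ 𝒯' ∈ refinements 𝒯₀, 𝒯' ∈ refinements 𝒯 →
      ∃ R : Finset Elem, R ⊆ 𝒯 ∧ 𝒯 \ 𝒯' ⊆ R ∧ (R.card : ℝ) ≤ Cref * ((𝒯 \ 𝒯').card : ℝ) ∧
        ‖uh 𝒯' - uh 𝒯‖ ^ 2 ≤ Cdlr ^ 2 * ∑ T ∈ R, η 𝒯 T ^ 2

end Axioms

/-! ### Approximation classes -/

/-- The error estimator `η(𝒯)`. -/
def estimator (η : Mesh → Elem → ℝ) (𝒯 : Mesh) : ℝ := √(∑ T ∈ 𝒯, η 𝒯 T ^ 2)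

/-- `sup_N min { N ^ s * η(𝒯) : 𝒯 ∈ 𝕋, #𝒯 - #𝒯₀ ≤ N }` in `[0, ∞]` for a set `𝕋` of
triangulations. For `𝕋` a set of refinements of `𝒯₀`, only finitely many `𝒯` compete for each `N`,
so the infimum is a minimum. -/
def approxNorm (𝕋 : Set Mesh) (𝒯₀ : Mesh) (η : Mesh → Elem → ℝ) (s : ℝ) : ℝ≥0∞ :=
  ⨆ N : ℕ, ⨅ 𝒯 ∈ {𝒯 ∈ 𝕋 | 𝒯.card ≤ 𝒯₀.card + N},
    ENNReal.ofReal ((N : ℝ) ^ s * estimator η 𝒯)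

/-- The approximation class with respect to a set `𝕋` of triangulations: all exact solutions `u`
of the variational problem with data `f ∈ F` for which the approximation norm, formed with the
estimator `η f` for these data, is finite. -/
def approxClass {X : Type*} [NormedAddCommGroup X] [InnerProductSpace ℝ X]
    (a : X →L[ℝ] X →L[ℝ] ℝ) (F : Set (X →L[ℝ] ℝ)) (η : (X →L[ℝ] ℝ) → Mesh → Elem → ℝ)
    (𝕋 : Set Mesh) (𝒯₀ : Mesh) (s : ℝ) : Set X :=
  {u | ∃ f ∈ F, (∀ v, a u v = f v) ∧ approxNorm 𝕋 𝒯₀ (η f) s < ∞}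

end AFEM

end

/-!
The inclusion of the graded class in the full class is trivial. For the converse, every conforming
refinement `𝒯` of `𝒯₀` gets a mildly graded refinement `𝒯'` such that the number of bisections
from `𝒯₀` to `𝒯'` is at most a constant times that from `𝒯₀` to `𝒯`
(`IsRootMesh.exists_gradedRefinement`). Stability, reduction and discrete reliability bound
`η(𝒯')` by a multiple of `η(𝒯)` (`exists_estimator_le`), and the classes can be compared
(`approxNorm_lt_top_of_comparable`).

The mesh `𝒯` is encoded by the set `I` of its bisected nodes, a finite tree in the binary forest
over `𝒯₀`, so that `𝒯 = leaves 𝒯₀ I` and `#𝒯 = #𝒯₀ + #I`. Because of the matching condition, the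
nodes of a fixed level `k` form a conforming mesh, the uniform refinement `uniformMesh 𝒯₀ k`
(`IsAdmissible.bisectAll`). Distances between nodes of equal level are measured there by the length
of chains of touching elements (`ball`). Two facts on these distances carry the proof.
* The number of elements touching a given one is bounded uniformly in `k`
  (`IsAdmissible.card_vertexStar_uniformMesh`, `IsAdmissible.card_ball_le`): an angle at a vertex is
  bisected at most once after the creation of the vertex, and the number of elements at an edge never
  exceeds the larger of two and its initial maximum.
* Passing to the ancestors three generations up halves distances (`ball_of_isDesc_three`), since
  three bisections halve the oscillation of the barycentric coordinates.

The tree of `𝒯'` arises from `I` by adding the `m`-balls around the nodes in `I`, then repeatedly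
the `m`-balls around the parents of the added nodes, and finally the elements of equal level that share
their refinement edge with one of these nodes (`closureTree`); here `m` depends on the grading
parameter only. By the contraction property, each node of this tree stays within a fixed
distance of a node of `I` of the same level (`Near.exists_mem`). As `I` contains with a node all its
ancestors, no summation over different levels is necessary, and the cardinality is bounded by a
multiple of `#I`. The balls around the parents yield the mild grading
(`IsRootMesh.level_le_of_mem_ball`). In particular, touching leaves differ by at most one level, and
then conformity follows from that of the uniform refinements, because the tree contains all or none
of the elements of one level with the same refinement edge.
-/

noncomputable section

namespace AFEM

open Elem
open scoped ENNReal

/-! ### Affine functions and faces of triangles -/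

/-- Affine functions can be prescribed at the vertices of a nondegenerate triangle. -/
theorem Elem.Nondegenerate.exists_affineMap {T : Elem} (hT : T.Nondegenerate) (α β γ : ℝ) :
    ∃ f : Plane →ᵃ[ℝ] ℝ, f T.apex = α ∧ f T.left = β ∧ f T.right = γ := by
  have hspan : affineSpan ℝ (Set.range ![T.apex, T.left, T.right]) = ⊤ := by
    rw [AffineIndependent.affineSpan_eq_top_iff_card_eq_finrank_add_one hT]
    simp
  let b : AffineBasis (Fin 3) ℝ Plane := ⟨_, hT, hspan⟩
  have h0 : b 0 = T.apex := rfl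
  have h1 : b 1 = T.left := rfl
  have h2 : b 2 = T.right := rfl
  refine ⟨α • b.coord 0 + β • b.coord 1 + γ • b.coord 2, ?_, ?_, ?_⟩
  · rw [← h0]; simp
  · rw [← h1]; simp
  · rw [← h2]; simp

/-- The points of a convex hull at which a nonnegative affine function vanishes are spanned by the
vertices at which it vanishes. -/
theorem mem_convexHull_zeros {A : Set Plane} {f : Plane →ᵃ[ℝ] ℝ} (hf : ∀ v ∈ A, 0 ≤ f v)
    {x : Plane} (hx : x ∈ convexHull ℝ A) (h0 : f x ≤ 0) :
    x ∈ convexHull ℝ {v | v ∈ A ∧ f v = 0} := by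
  have hpos : ∀ y ∈ convexHull ℝ {v | v ∈ A ∧ 0 < f v}, 0 < f y := by
    intro y hy
    have hc : Convex ℝ {y | 0 < f y} := (convex_Ioi (0 : ℝ)).affine_preimage f
    exact convexHull_min (fun v hv => hv.2) hc hy
  have hzero : ∀ y ∈ convexHull ℝ {v | v ∈ A ∧ f v = 0}, f y = 0 := by
    intro y hy
    have hc : Convex ℝ {y | f y = 0} := (convex_singleton (0 : ℝ)).affine_preimage f
    exact convexHull_min (fun v hv => hv.2) hc hy
  have hA : A = {v | v ∈ A ∧ f v = 0} ∪ {v | v ∈ A ∧ 0 < f v} := by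
    ext v
    constructor
    · intro hv
      rcases (hf v hv).eq_or_lt with h | h
      · exact Or.inl ⟨hv, h.symm⟩
      · exact Or.inr ⟨hv, h⟩
    · rintro (h | h) <;> exact h.1
  rcases Set.eq_empty_or_nonempty {v | v ∈ A ∧ f v = 0} with hB | hB
  · rw [hB, Set.empty_union] at hA
    rw [hA] at hx
    exact absurd (hpos x hx) (not_lt.mpr h0)
  rcases Set.eq_empty_or_nonempty {v | v ∈ A ∧ 0 < f v} with hC | hC
  · rw [hC, Set.union_empty] at hA
    rwa [← hA]
  rw [hA, convexHull_union hB hC, mem_convexJoin] at hx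
  obtain ⟨b, hb, c, hc, s, t, hs, ht, hst, rfl⟩ := hx
  have hfx : f (s • b + t • c) = s • f b + t • f c :=
    Convex.combo_affine_apply hst
  rw [hfx, hzero b hb, smul_zero, zero_add, smul_eq_mul] at h0
  have ht0 : t = 0 := by
    by_contra hne
    exact absurd (mul_pos (lt_of_le_of_ne ht (Ne.symm hne)) (hpos c hc)) (not_lt.mpr h0)
  have hs1 : s = 1 := by linarith
  simpa [ht0, hs1] using hb

theorem affine_eq_of_mem_convexHull {W : Set Plane} {f : Plane →ᵃ[ℝ] ℝ} {t : ℝ}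
    (hf : ∀ v ∈ W, f v = t) {x : Plane} (hx : x ∈ convexHull ℝ W) : f x = t :=
  convexHull_min (t := {y | f y = t}) hf ((convex_singleton t).affine_preimage f) hx

theorem affine_midpoint (f : Plane →ᵃ[ℝ] ℝ) (x y : Plane) :
    f (midpoint ℝ x y) = (f x + f y) / 2 := by
  rw [AffineMap.map_midpoint, midpoint_eq_smul_add]
  simp; ring

namespace Elem

/-- `S` is one of the two elements into which `T` is bisected. -/
def IsSon (S T : Elem) : Prop := S = T.son₁ ∨ S = T.son₂

theorem IsSon.level_eq {S T : Elem} (h : S.IsSon T) : S.level = T.level + 1 := by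
  rcases h with rfl | rfl <;> rfl

theorem verts_subset_carrier (T : Elem) : T.verts ⊆ T.carrier := subset_convexHull ℝ _

theorem apex_mem_verts (T : Elem) : T.apex ∈ T.verts := by simp [verts]

theorem apex_mem_carrier (T : Elem) : T.apex ∈ T.carrier :=
  T.verts_subset_carrier T.apex_mem_verts

theorem refEdge_subset_verts (T : Elem) : T.refEdge ⊆ T.verts := by
  simp [refEdge, verts]

/-- The two sons of an element, up to the symmetry that exchanges the endpoints `b` and `c` of the
refinement edge: the son is spanned by the midpoint of this edge, the apex, and `b`. -/
theorem IsSon.exists_endpoints {S T : Elem} (h : S.IsSon T) (hT : T.Nondegenerate) :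
    ∃ b c : Plane, T.verts = {T.apex, b, c} ∧ T.refEdge = {b, c} ∧
      S.verts = {midpoint ℝ b c, T.apex, b} ∧ S.apex = midpoint ℝ b c ∧
      ∀ α β γ : ℝ, ∃ f : Plane →ᵃ[ℝ] ℝ, f T.apex = α ∧ f b = β ∧ f c = γ := by
  rcases h with rfl | rfl
  · exact ⟨T.left, T.right, rfl, rfl, rfl, rfl, hT.exists_affineMap⟩
  · refine ⟨T.right, T.left, ?_, Set.pair_comm _ _, ?_, midpoint_comm _ _, ?_⟩
    · simp only [verts, Set.pair_comm]
    · simp only [verts, son₂, midpoint_comm]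
    · intro α β γ
      obtain ⟨f, h1, h2, h3⟩ := hT.exists_affineMap α γ β
      exact ⟨f, h1, h3, h2⟩

theorem Nondegenerate.apex_ne_left {T : Elem} (hT : T.Nondegenerate) : T.apex ≠ T.left := by
  intro h
  obtain ⟨f, h1, h2, -⟩ := hT.exists_affineMap 0 1 0
  rw [h, h2] at h1; norm_num at h1

theorem Nondegenerate.apex_ne_right {T : Elem} (hT : T.Nondegenerate) : T.apex ≠ T.right := by
  intro h
  obtain ⟨f, h1, -, h2⟩ := hT.exists_affineMap 0 0 1
  rw [h, h2] at h1; norm_num at h1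

theorem Nondegenerate.left_ne_right {T : Elem} (hT : T.Nondegenerate) : T.left ≠ T.right := by
  intro h
  obtain ⟨f, -, h1, h2⟩ := hT.exists_affineMap 0 0 1
  rw [h, h2] at h1; norm_num at h1

theorem nondegenerate_iff {T : Elem} : T.Nondegenerate ↔
    ∀ x y z : ℝ, x + y + z = 0 → x • T.apex + y • T.left + z • T.right = 0 →
      x = 0 ∧ y = 0 ∧ z = 0 := by
  rw [Nondegenerate, affineIndependent_iff_of_fintype]
  constructor
  · intro h x y z h1 h2
    have := h ![x, y, z] (by simpa [Fin.sum_univ_three] using h1) (by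
      rw [Finset.weightedVSub_eq_linear_combination Finset.univ
        (by simpa [Fin.sum_univ_three] using h1)]
      simpa [Fin.sum_univ_three] using h2)
    exact ⟨by simpa using this 0, by simpa using this 1, by simpa using this 2⟩
  · intro h w h1 h2
    rw [Finset.weightedVSub_eq_linear_combination Finset.univ h1] at h2
    rw [Fin.sum_univ_three] at h1
    have := h (w 0) (w 1) (w 2) h1 (by simpa [Fin.sum_univ_three] using h2)
    intro i
    fin_cases i
    exacts [this.1, this.2.1, this.2.2]

theorem IsSon.nondegenerate {S T : Elem} (h : S.IsSon T) (hT : T.Nondegenerate) :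
    S.Nondegenerate := by
  rw [nondegenerate_iff] at hT ⊢
  intro x y z h1 h2
  rcases h with rfl | rfl
  · obtain ⟨p, q, r⟩ := hT y (x / 2 + z) (x / 2) (by linarith) (by
      rw [← h2]; simp only [son₁, midpoint_eq_smul_add, invOf_eq_inv]; module)
    exact ⟨by linarith, p, by linarith⟩
  · obtain ⟨p, q, r⟩ := hT y (x / 2) (x / 2 + z) (by linarith) (by
      rw [← h2]; simp only [son₂, midpoint_eq_smul_add, invOf_eq_inv]; module)
    exact ⟨by linarith, p, by linarith⟩

theorem IsSon.carrier_subset {S T : Elem} (h : S.IsSon T) : S.carrier ⊆ T.carrier := by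
  have hm : midpoint ℝ T.left T.right ∈ T.carrier :=
    (convex_convexHull ℝ _).midpoint_mem (T.verts_subset_carrier (by simp [verts]))
      (T.verts_subset_carrier (by simp [verts]))
  refine convexHull_min ?_ (convex_convexHull ℝ _)
  rcases h with rfl | rfl
  all_goals
    rintro v (rfl | rfl | rfl)
    · exact hm
    · exact T.verts_subset_carrier (by simp [verts, son₁, son₂])
    · exact T.verts_subset_carrier (by simp [verts, son₁, son₂])

theorem carrier_subset_sons {T : Elem} {x : Plane} (hx : x ∈ T.carrier) :
    x ∈ T.son₁.carrier ∨ x ∈ T.son₂.carrier := by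
  have h : T.carrier ⊆ T.son₁.carrier ∪ T.son₂.carrier := by
    intro x hx
    rw [carrier, verts, convexHull_insert (by simp), convexHull_pair] at hx
    rw [mem_convexJoin] at hx
    obtain ⟨p, hp, q, hq, hx⟩ := hx
    rw [Set.mem_singleton_iff] at hp
    subst hp
    have key : q ∈ segment ℝ (midpoint ℝ T.left T.right) T.left ∨
        q ∈ segment ℝ (midpoint ℝ T.left T.right) T.right := by
      obtain ⟨s, t, hs, ht, hst, rfl⟩ := hq
      rcases le_total t s with h | h
      · refine Or.inl ⟨2 * t, s - t, by linarith, by linarith, by linarith, ?_⟩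
        rw [midpoint_eq_smul_add, invOf_eq_inv]; module
      · refine Or.inr ⟨2 * s, t - s, by linarith, by linarith, by linarith, ?_⟩
        rw [midpoint_eq_smul_add, invOf_eq_inv]; module
    rcases key with h | h
    · left
      have hc := convex_convexHull ℝ T.son₁.verts
      refine hc.segment_subset (T.son₁.verts_subset_carrier (by simp [verts, son₁]))
        (hc.segment_subset (T.son₁.verts_subset_carrier (by simp [verts, son₁]))
          (T.son₁.verts_subset_carrier (by simp [verts, son₁])) h) hx
    · right
      have hc := convex_convexHull ℝ T.son₂.verts
      refine hc.segment_subset (T.son₂.verts_subset_carrier (by simp [verts, son₂]))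
        (hc.segment_subset (T.son₂.verts_subset_carrier (by simp [verts, son₂]))
          (T.son₂.verts_subset_carrier (by simp [verts, son₂])) h) hx
  exact h hx

end Elem

/-! ### Uniform refinements are conforming -/

/-- If a face of `T` contains the midpoint of the refinement edge, it contains the whole edge. -/
theorem Elem.Nondegenerate.refEdge_subset_of_midpoint_mem {T : Elem} (hT : T.Nondegenerate)
    {W : Set Plane} (hW : W ⊆ T.verts) (hm : midpoint ℝ T.left T.right ∈ convexHull ℝ W) :
    T.refEdge ⊆ W := by
  have aux : ∀ f : Plane →ᵃ[ℝ] ℝ, (∀ v ∈ W, f v = 0) → f T.left + f T.right = 0 := by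
    intro f hf
    have := affine_eq_of_mem_convexHull hf hm
    rw [affine_midpoint] at this
    linarith
  rintro v (rfl | rfl)
  · by_contra hv
    obtain ⟨f, h1, h2, h3⟩ := hT.exists_affineMap 0 1 0
    have := aux f (fun w hw => by
      rcases hW hw with rfl | rfl | rfl
      · exact h1
      · exact absurd hw hv
      · exact h3)
    linarith
  · by_contra hv
    obtain ⟨f, h1, h2, h3⟩ := hT.exists_affineMap 0 0 1
    have := aux f (fun w hw => by
      rcases hW hw with rfl | rfl | rfl
      · exact h1
      · exact h2
      · exact absurd hw hv)
    linarith

theorem Elem.Nondegenerate.midpoint_notMem_verts {T : Elem} (hT : T.Nondegenerate) :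
    midpoint ℝ T.left T.right ∉ T.verts := by
  intro h
  have := hT.refEdge_subset_of_midpoint_mem (W := {midpoint ℝ T.left T.right})
    (by simpa using h) (by simp)
  have h1 : T.left = midpoint ℝ T.left T.right := this (by simp [refEdge])
  have h2 : T.right = midpoint ℝ T.left T.right := this (by simp [refEdge])
  exact hT.left_ne_right (h1.trans h2.symm)

/-- A face of a triangle is separated from the other vertices by an affine function. -/
theorem Elem.Nondegenerate.exists_indicator {T : Elem} (hT : T.Nondegenerate) (W : Set Plane) :
    ∃ f : Plane →ᵃ[ℝ] ℝ, ∀ v ∈ T.verts, (v ∈ W → f v = 0) ∧ (v ∉ W → f v = 1) := by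
  classical
  obtain ⟨f, h1, h2, h3⟩ := hT.exists_affineMap (if T.apex ∈ W then 0 else 1)
    (if T.left ∈ W then 0 else 1) (if T.right ∈ W then 0 else 1)
  refine ⟨f, ?_⟩
  rintro v (rfl | rfl | rfl) <;> constructor <;> intro hv <;> simp_all

theorem Elem.Nondegenerate.convexHull_inter {T : Elem} (hT : T.Nondegenerate) {W W' : Set Plane}
    (hW : W ⊆ T.verts) (hW' : W' ⊆ T.verts) {x : Plane} (hx : x ∈ convexHull ℝ W)
    (hx' : x ∈ convexHull ℝ W') : x ∈ convexHull ℝ (W ∩ W') := by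
  obtain ⟨f, hf⟩ := hT.exists_indicator W'
  have hfx : f x = 0 := affine_eq_of_mem_convexHull (fun v hv => (hf v (hW' hv)).1 hv) hx'
  refine convexHull_mono ?_ (mem_convexHull_zeros (f := f) (A := W) ?_ hx hfx.le)
  · rintro v ⟨hv, h0⟩
    refine ⟨hv, by_contra fun hv' => ?_⟩
    rw [(hf v (hW hv)).2 hv'] at h0
    exact one_ne_zero h0
  · intro v hv
    by_cases hv' : v ∈ W'
    · exact ((hf v (hW hv)).1 hv').ge
    · rw [(hf v (hW hv)).2 hv']; exact zero_le_one

/-- A son meets a face of its parent that does not contain the refinement edge only in the part of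
this face spanned by the vertices of the son. -/
theorem Elem.IsSon.inter_face {S P : Elem} (h : S.IsSon P) (hP : P.Nondegenerate)
    {W : Set Plane} (hW : W ⊆ P.verts) (hE : ¬ P.refEdge ⊆ W) {x : Plane} (hxS : x ∈ S.carrier)
    (hxW : x ∈ convexHull ℝ W) : x ∈ convexHull ℝ (S.verts ∩ W) := by
  obtain ⟨b, c, hPv, hPe, hSv, -, hf⟩ := h.exists_endpoints hP
  rw [hPe] at hE
  rw [hPv] at hW
  by_cases hc : c ∈ W
  · have hb : b ∉ W := fun hb => hE (by rintro v (rfl | rfl) <;> assumption)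
    obtain ⟨f, f1, f2, f3⟩ := hf 0 1 0
    have hfx : f x = 0 := by
      refine affine_eq_of_mem_convexHull (fun v hv => ?_) hxW
      rcases hW hv with rfl | rfl | rfl
      · exact f1
      · exact absurd hv hb
      · exact f3
    have hx := mem_convexHull_zeros (f := f) (A := S.verts) (by
      rw [hSv]
      rintro v (rfl | rfl | rfl)
      · rw [affine_midpoint]; linarith
      · exact f1.ge
      · linarith) hxS hfx.le
    have hxa : x ∈ convexHull ℝ {P.apex} := by
      refine convexHull_mono ?_ hx
      rw [hSv]
      rintro v ⟨rfl | rfl | rfl, hv⟩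
      · rw [affine_midpoint] at hv; linarith
      · rfl
      · linarith
    rw [convexHull_singleton, Set.mem_singleton_iff] at hxa
    subst hxa
    have ha : P.apex ∈ W := by
      by_contra ha
      obtain ⟨g, g1, g2, g3⟩ := hf 1 0 0
      have : g P.apex = 0 := by
        refine affine_eq_of_mem_convexHull (fun v hv => ?_) hxW
        rcases hW hv with rfl | rfl | rfl
        · exact absurd hv ha
        · exact absurd hv hb
        · exact g3
      linarith
    have hmem : P.apex ∈ S.verts ∩ W := ⟨by rw [hSv]; simp, ha⟩
    exact subset_convexHull ℝ _ hmem
  · refine convexHull_mono ?_ hxW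
    intro v hv
    refine ⟨?_, hv⟩
    rw [hSv]
    rcases hW hv with rfl | rfl | rfl
    · simp
    · simp
    · exact absurd hv hc

/-- The part of the refinement edge of the parent that belongs to a son is a half of this edge. -/
theorem Elem.IsSon.inter_refEdge {S P : Elem} (h : S.IsSon P) (hP : P.Nondegenerate) :
    ∃ b ∈ P.refEdge, b ∈ S.verts ∧ midpoint ℝ P.left P.right ∈ S.verts ∧
      ∀ x ∈ S.carrier, x ∈ convexHull ℝ P.refEdge →
        x ∈ convexHull ℝ {midpoint ℝ P.left P.right, b} := by
  have hm : midpoint ℝ P.left P.right ∈ S.verts := by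
    rcases h with rfl | rfl <;> simp [verts, son₁, son₂]
  have hm' : S.apex = midpoint ℝ P.left P.right := by
    rcases h with rfl | rfl <;> rfl
  obtain ⟨b, c, hPv, hPe, hSv, hSa, hf⟩ := h.exists_endpoints hP
  refine ⟨b, by rw [hPe]; simp, by rw [hSv]; simp, hm, fun x hxS hxE => ?_⟩
  rw [hm'] at hSa
  rw [hSa]
  obtain ⟨f, f1, f2, f3⟩ := hf 1 0 0
  have hfx : f x = 0 := by
    refine affine_eq_of_mem_convexHull (fun v hv => ?_) hxE
    rw [hPe] at hv
    rcases hv with rfl | rfl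
    · exact f2
    · exact f3
  have hx := mem_convexHull_zeros (f := f) (A := S.verts) (by
    rw [hSv]
    rintro v (rfl | rfl | rfl)
    · rw [affine_midpoint]; linarith
    · linarith
    · linarith) hxS hfx.le
  refine convexHull_mono ?_ hx
  rw [hSv]
  rintro v ⟨rfl | rfl | rfl, hv⟩
  · simp
  · linarith
  · simp

theorem Elem.midpoint_eq_of_refEdge_eq {P P' : Elem} (he : P.refEdge = P'.refEdge) :
    midpoint ℝ P.left P.right = midpoint ℝ P'.left P'.right := by
  rcases Set.pair_eq_pair_iff.mp he with ⟨h1, h2⟩ | ⟨h1, h2⟩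
  · rw [h1, h2]
  · rw [h1, h2, midpoint_comm]

/-- A conforming mesh of nondegenerate elements with matching refinement edges. -/
structure IsAdmissible (𝒯 : Mesh) : Prop where
  nondegenerate : ∀ T ∈ 𝒯, T.Nondegenerate
  conforming : IsConforming 𝒯
  matching : HasMatchingRefEdges 𝒯

namespace IsAdmissible

variable {𝒯 : Mesh}

theorem inter_carrier (h : IsAdmissible 𝒯) {P P' : Elem} (hP : P ∈ 𝒯) (hP' : P' ∈ 𝒯) :
    P.carrier ∩ P'.carrier = convexHull ℝ (P.verts ∩ P'.verts) := by
  by_cases hne : P = P'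
  · subst hne; simp [carrier]
  · exact (h.conforming P hP P' hP' hne).2

theorem eq_of_verts_eq (h : IsAdmissible 𝒯) {P P' : Elem} (hP : P ∈ 𝒯) (hP' : P' ∈ 𝒯)
    (hv : P.verts = P'.verts) : P = P' := by
  by_contra hne
  exact (h.conforming P hP P' hP' hne).1 hv

/-- An element that contains the midpoint of the refinement edge of `P` has the same refinement
edge. -/
theorem refEdge_eq_of_midpoint_mem (h : IsAdmissible 𝒯) {P P' : Elem} (hP : P ∈ 𝒯) (hP' : P' ∈ 𝒯)
    (hm : midpoint ℝ P.left P.right ∈ P'.carrier) : P.refEdge = P'.refEdge := by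
  have hmP : midpoint ℝ P.left P.right ∈ P.carrier :=
    (convex_convexHull ℝ _).midpoint_mem (P.verts_subset_carrier (by simp [verts]))
      (P.verts_subset_carrier (by simp [verts]))
  have hmW : midpoint ℝ P.left P.right ∈ convexHull ℝ (P.verts ∩ P'.verts) := by
    rw [← h.inter_carrier hP hP']; exact ⟨hmP, hm⟩
  exact h.matching P hP P' hP' fun v hv =>
    ((h.nondegenerate P hP).refEdge_subset_of_midpoint_mem Set.inter_subset_left hmW hv).2

theorem midpoint_notMem_verts (h : IsAdmissible 𝒯) {P P' : Elem} (hP : P ∈ 𝒯) (hP' : P' ∈ 𝒯) :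
    midpoint ℝ P.left P.right ∉ P'.verts := by
  intro hm
  have he := h.refEdge_eq_of_midpoint_mem hP hP' (P'.verts_subset_carrier hm)
  rw [midpoint_eq_of_refEdge_eq he] at hm
  exact (h.nondegenerate P' hP').midpoint_notMem_verts hm

/-- Two elements with a common refinement edge and a common apex coincide. -/
theorem eq_of_refEdge_eq (h : IsAdmissible 𝒯) {P P' : Elem} (hP : P ∈ 𝒯) (hP' : P' ∈ 𝒯)
    (he : P.refEdge = P'.refEdge) (ha : P.apex = P'.apex) : P = P' := by
  apply h.eq_of_verts_eq hP hP'
  change insert P.apex P.refEdge = insert P'.apex P'.refEdge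
  rw [he, ha]

theorem inter_sons (h : IsAdmissible 𝒯) {P P' S S' : Elem} (hP : P ∈ 𝒯) (hP' : P' ∈ 𝒯)
    (hS : S.IsSon P) (hS' : S'.IsSon P') (hne : P ≠ P') :
    S.carrier ∩ S'.carrier ⊆ convexHull ℝ (S.verts ∩ S'.verts) := by
  rintro x ⟨hx, hx'⟩
  have nP := h.nondegenerate P hP
  have nP' := h.nondegenerate P' hP'
  have hxW : x ∈ convexHull ℝ (P.verts ∩ P'.verts) := by
    rw [← h.inter_carrier hP hP']; exact ⟨hS.carrier_subset hx, hS'.carrier_subset hx'⟩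
  by_cases he : P.refEdge = P'.refEdge
  · obtain ⟨b, hb, hbS, hmS, key⟩ := hS.inter_refEdge nP
    obtain ⟨b', hb', hbS', hmS', key'⟩ := hS'.inter_refEdge nP'
    have hW : P.verts ∩ P'.verts ⊆ P.refEdge := by
      rintro v ⟨hv, hv'⟩
      rcases hv with rfl | hv
      · rcases hv' with hv' | hv'
        · exact absurd (h.eq_of_refEdge_eq hP hP' he hv') hne
        · rw [he]; exact hv'
      · exact hv
    have hxE := convexHull_mono hW hxW
    have k := key x hx hxE
    have k' := key' x hx' (he ▸ hxE)
    rw [← midpoint_eq_of_refEdge_eq he] at k' hmS'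
    by_cases hbb : b = b'
    · subst hbb
      refine convexHull_mono ?_ k
      rintro v (rfl | rfl)
      · exact ⟨hmS, hmS'⟩
      · exact ⟨hbS, hbS'⟩
    · -- The two halves of the edge meet only in its midpoint.
      have hxm : x = midpoint ℝ P.left P.right := by
        have key2 : ∀ f : Plane →ᵃ[ℝ] ℝ, f b = 1 → f b' = -1 → f P.left + f P.right = 0 →
            x = midpoint ℝ P.left P.right := by
          intro f h1 h2 h3
          have hfx : f x ≤ 0 := by
            refine convexHull_min (t := {y | f y ≤ 0}) ?_
              ((convex_Iic (0 : ℝ)).affine_preimage f) k'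
            rintro v (rfl | rfl)
            · change f _ ≤ 0
              rw [affine_midpoint]; linarith
            · change f _ ≤ 0
              linarith
          have hx := mem_convexHull_zeros (f := f) (by
            rintro v (rfl | rfl)
            · rw [affine_midpoint]; linarith
            · linarith) k hfx
          have hx1 : x ∈ convexHull ℝ {midpoint ℝ P.left P.right} := by
            refine convexHull_mono ?_ hx
            rintro v ⟨rfl | rfl, hv⟩
            · rfl
            · linarith
          simpa using hx1
        rw [← he] at hb'
        rcases hb with rfl | rfl <;> rcases hb' with rfl | rfl
        · exact absurd rfl hbb
        · obtain ⟨f, -, h2, h3⟩ := nP.exists_affineMap 0 1 (-1)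
          exact key2 f h2 h3 (by linarith)
        · obtain ⟨f, -, h2, h3⟩ := nP.exists_affineMap 0 (-1) 1
          exact key2 f h3 h2 (by linarith)
        · exact absurd rfl hbb
      rw [hxm]
      exact subset_convexHull ℝ _ ⟨hmS, hmS'⟩
  · have h1 : ¬ P.refEdge ⊆ P.verts ∩ P'.verts := fun hs =>
      he (h.matching P hP P' hP' fun v hv => (hs hv).2)
    have h2 : ¬ P'.refEdge ⊆ P.verts ∩ P'.verts := fun hs =>
      he (h.matching P' hP' P hP fun v hv => (hs hv).1).symm
    have k1 := hS.inter_face nP Set.inter_subset_left h1 hx hxW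
    have k2 := hS'.inter_face nP' Set.inter_subset_right h2 hx' hxW
    refine convexHull_mono ?_ (nP.convexHull_inter (W := S.verts ∩ (P.verts ∩ P'.verts))
      (W' := S'.verts ∩ (P.verts ∩ P'.verts)) (fun v hv => hv.2.1) (fun v hv => hv.2.1) k1 k2)
    exact fun v hv => ⟨hv.1.1, hv.2.1⟩

theorem verts_sons_ne (h : IsAdmissible 𝒯) {P P' S S' : Elem} (hP : P ∈ 𝒯) (hP' : P' ∈ 𝒯)
    (hS : S.IsSon P) (hS' : S'.IsSon P') (hne : P ≠ P') : S.verts ≠ S'.verts := by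
  intro hv
  have nP := h.nondegenerate P hP
  have hm : midpoint ℝ P.left P.right ∈ S.verts := by
    rcases hS with rfl | rfl <;> simp [verts, son₁, son₂]
  have he := h.refEdge_eq_of_midpoint_mem hP hP'
    (hS'.carrier_subset (S'.verts_subset_carrier (hv ▸ hm)))
  have ha : P.apex ∈ S'.verts := by
    rw [← hv]
    rcases hS with rfl | rfl <;> simp [verts, son₁, son₂]
  have hsub : S'.verts ⊆ {midpoint ℝ P'.left P'.right, P'.apex} ∪ P'.refEdge := by
    rcases hS' with rfl | rfl
    · rintro v (rfl | rfl | rfl) <;> simp [son₁, refEdge]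
    · rintro v (rfl | rfl | rfl) <;> simp [son₂, refEdge]
  rw [← midpoint_eq_of_refEdge_eq he, ← he] at hsub
  rcases hsub ha with (h1 | h1) | (h1 | h1)
  · exact nP.midpoint_notMem_verts (h1 ▸ P.apex_mem_verts)
  · exact hne (h.eq_of_refEdge_eq hP hP' he h1)
  · exact nP.apex_ne_left h1
  · exact nP.apex_ne_right h1

end IsAdmissible

theorem Elem.Nondegenerate.verts_son₁_ne {P : Elem} (hP : P.Nondegenerate) :
    P.son₁.verts ≠ P.son₂.verts := by
  intro hv
  have hl : P.left ∈ P.son₂.verts := by rw [← hv]; simp [verts, son₁]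
  rcases hl with h | h | h
  · refine hP.midpoint_notMem_verts ?_
    change P.left = midpoint ℝ P.left P.right at h
    rw [← h]
    simp [verts]
  · exact hP.apex_ne_left h.symm
  · exact hP.left_ne_right h

theorem Elem.Nondegenerate.son₁_ne_son₂ {P : Elem} (hP : P.Nondegenerate) : P.son₁ ≠ P.son₂ :=
  fun h => hP.verts_son₁_ne (congrArg verts h)

theorem Elem.Nondegenerate.son₁_inter_son₂ {P : Elem} (hP : P.Nondegenerate) :
    P.son₁.carrier ∩ P.son₂.carrier ⊆ convexHull ℝ (P.son₁.verts ∩ P.son₂.verts) := by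
  rintro x ⟨hx, hx'⟩
  obtain ⟨f, f1, f2, f3⟩ := hP.exists_affineMap 0 1 (-1)
  have hfx : f x ≤ 0 := by
    refine convexHull_min (t := {y | f y ≤ 0}) ?_ ((convex_Iic (0 : ℝ)).affine_preimage f) hx'
    rintro v (rfl | rfl | rfl)
    · change f (midpoint ℝ _ _) ≤ 0
      rw [affine_midpoint]; linarith
    · exact f1.le
    · change f P.right ≤ 0
      linarith
  refine convexHull_mono ?_ (mem_convexHull_zeros (f := f) (A := P.son₁.verts) ?_ hx hfx)
  · rintro v ⟨rfl | rfl | rfl, hv⟩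
    · simp [verts, son₁, son₂]
    · simp [verts, son₁, son₂]
    · change f P.left = 0 at hv
      linarith
  · rintro v (rfl | rfl | rfl)
    · change 0 ≤ f (midpoint ℝ _ _)
      rw [affine_midpoint]; linarith
    · exact f1.ge
    · change 0 ≤ f P.left
      linarith

/-- Bisection of all elements of a mesh. -/
def bisectAll (𝒯 : Mesh) : Mesh := 𝒯.image son₁ ∪ 𝒯.image son₂

theorem mem_bisectAll {𝒯 : Mesh} {S : Elem} : S ∈ bisectAll 𝒯 ↔ ∃ P ∈ 𝒯, S.IsSon P := by
  simp only [bisectAll, Finset.mem_union, Finset.mem_image, IsSon]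
  constructor
  · rintro (⟨P, hP, rfl⟩ | ⟨P, hP, rfl⟩)
    exacts [⟨P, hP, Or.inl rfl⟩, ⟨P, hP, Or.inr rfl⟩]
  · rintro ⟨P, hP, rfl | rfl⟩
    exacts [Or.inl ⟨P, hP, rfl⟩, Or.inr ⟨P, hP, rfl⟩]

/-- Every vertex of a son is the midpoint of the refinement edge or a vertex of the parent. -/
theorem Elem.IsSon.mem_verts {S P : Elem} (h : S.IsSon P) {v : Plane} (hv : v ∈ S.verts) :
    v = midpoint ℝ P.left P.right ∨ v ∈ P.verts := by
  rcases h with rfl | rfl <;> rcases hv with rfl | rfl | rfl <;> simp [verts, son₁, son₂]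

theorem Elem.IsSon.refEdge_subset {S P : Elem} (h : S.IsSon P) : S.refEdge ⊆ P.verts := by
  rcases h with rfl | rfl <;> rintro v (rfl | rfl) <;> simp [verts, son₁, son₂]

theorem inter_carrier_eq_of_subset {T T' : Elem}
    (h : T.carrier ∩ T'.carrier ⊆ convexHull ℝ (T.verts ∩ T'.verts)) :
    T.carrier ∩ T'.carrier = convexHull ℝ (T.verts ∩ T'.verts) :=
  h.antisymm (Set.subset_inter (convexHull_mono Set.inter_subset_left)
    (convexHull_mono Set.inter_subset_right))

/-- Uniform bisection preserves conformity and the matching condition: the bisected edges are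
exactly the refinement edges, and the refinement edges of the sons are the other edges. -/
theorem IsAdmissible.bisectAll {𝒯 : Mesh} (h : IsAdmissible 𝒯) : IsAdmissible (bisectAll 𝒯) where
  nondegenerate := by
    intro S hS
    obtain ⟨P, hP, hSP⟩ := mem_bisectAll.mp hS
    exact hSP.nondegenerate (h.nondegenerate P hP)
  conforming := by
    intro S hS S' hS' hne
    obtain ⟨P, hP, hSP⟩ := mem_bisectAll.mp hS
    obtain ⟨P', hP', hSP'⟩ := mem_bisectAll.mp hS'
    by_cases hPP : P = P'
    · subst hPP
      have nP := h.nondegenerate P hP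
      rcases hSP with rfl | rfl <;> rcases hSP' with rfl | rfl
      · exact absurd rfl hne
      · exact ⟨nP.verts_son₁_ne, inter_carrier_eq_of_subset nP.son₁_inter_son₂⟩
      · refine ⟨nP.verts_son₁_ne.symm, ?_⟩
        rw [Set.inter_comm, Set.inter_comm (verts _)]
        exact inter_carrier_eq_of_subset nP.son₁_inter_son₂
      · exact absurd rfl hne
    · exact ⟨h.verts_sons_ne hP hP' hSP hSP' hPP,
        inter_carrier_eq_of_subset (h.inter_sons hP hP' hSP hSP' hPP)⟩
  matching := by
    intro S hS S' hS' hsub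
    obtain ⟨P, hP, hSP⟩ := mem_bisectAll.mp hS
    obtain ⟨P', hP', hSP'⟩ := mem_bisectAll.mp hS'
    -- The midpoint of a refinement edge is not a vertex of the coarse mesh.
    have hsub' : S.refEdge ⊆ S'.refEdge := by
      intro v hv
      rcases hsub hv with hv' | hv'
      · have : v = midpoint ℝ P'.left P'.right := by rcases hSP' with rfl | rfl <;> exact hv'
        exact absurd (this ▸ hSP.refEdge_subset hv) (h.midpoint_notMem_verts hP' hP)
      · exact hv'
    have hlr := (hSP.nondegenerate (h.nondegenerate P hP)).left_ne_right
    refine Set.Subset.antisymm hsub' ?_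
    have hl : S.left ∈ S'.refEdge := hsub' (by simp [refEdge])
    have hr : S.right ∈ S'.refEdge := hsub' (by simp [refEdge])
    simp only [refEdge, Set.mem_insert_iff, Set.mem_singleton_iff] at hl hr
    rintro v (rfl | rfl) <;> simp only [refEdge, Set.mem_insert_iff, Set.mem_singleton_iff] <;>
      grind

/-- The mesh obtained from `𝒯` by `k` uniform bisections. -/
def uniformMesh (𝒯 : Mesh) : ℕ → Mesh
  | 0 => 𝒯
  | k + 1 => bisectAll (uniformMesh 𝒯 k)

theorem mem_uniformMesh_succ {𝒯 : Mesh} {k : ℕ} {S : Elem} :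
    S ∈ uniformMesh 𝒯 (k + 1) ↔ ∃ P ∈ uniformMesh 𝒯 k, S.IsSon P := mem_bisectAll

theorem IsAdmissible.uniformMesh {𝒯 : Mesh} (h : IsAdmissible 𝒯) (k : ℕ) :
    IsAdmissible (uniformMesh 𝒯 k) := by
  induction k with
  | zero => exact h
  | succ k ih => exact ih.bisectAll

theorem IsAdmissible.eq_of_isSon {𝒯 : Mesh} (h : IsAdmissible 𝒯) {P P' S : Elem} (hP : P ∈ 𝒯)
    (hP' : P' ∈ 𝒯) (hS : S.IsSon P) (hS' : S.IsSon P') : P = P' := by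
  by_contra hne
  exact h.verts_sons_ne hP hP' hS hS' hne rfl

/-! ### Bounded valence of uniform refinements -/

open scoped Classical in
/-- The elements of `𝒯` with vertices `x` and `y`; for `x = y` these are all elements at the
vertex `x`. -/
def edgeStar (𝒯 : Mesh) (x y : Plane) : Finset Elem := {T ∈ 𝒯 | x ∈ T.verts ∧ y ∈ T.verts}

open scoped Classical in
/-- The elements of `𝒯` with newest vertex `z`. -/
def apexStar (𝒯 : Mesh) (z : Plane) : Finset Elem := {T ∈ 𝒯 | T.apex = z}

theorem mem_edgeStar {𝒯 : Mesh} {x y : Plane} {T : Elem} :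
    T ∈ edgeStar 𝒯 x y ↔ T ∈ 𝒯 ∧ x ∈ T.verts ∧ y ∈ T.verts := by simp [edgeStar]

theorem mem_apexStar {𝒯 : Mesh} {z : Plane} {T : Elem} :
    T ∈ apexStar 𝒯 z ↔ T ∈ 𝒯 ∧ T.apex = z := by simp [apexStar]

theorem card_edgeStar_le (𝒯 : Mesh) (x y : Plane) : (edgeStar 𝒯 x y).card ≤ 𝒯.card :=
  Finset.card_le_card fun _ hT => (mem_edgeStar.mp hT).1

theorem card_apexStar_le (𝒯 : Mesh) (z : Plane) : (apexStar 𝒯 z).card ≤ 𝒯.card :=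
  Finset.card_le_card fun _ hT => (mem_apexStar.mp hT).1

theorem edgeStar_comm (𝒯 : Mesh) (x y : Plane) : edgeStar 𝒯 x y = edgeStar 𝒯 y x := by
  ext T; simp only [mem_edgeStar, and_comm]

open scoped Classical in
/-- The first son of `P` if it has the vertices `x` and `y`, and otherwise the second son. -/
def sonWith (x y : Plane) (P : Elem) : Elem :=
  if x ∈ P.son₁.verts ∧ y ∈ P.son₁.verts then P.son₁ else P.son₂

theorem Elem.IsSon.eq_sonWith {S P : Elem} (h : S.IsSon P) {x y : Plane} (hx : x ∈ S.verts)
    (hy : y ∈ S.verts)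
    (h2 : S = P.son₂ → ¬ (x ∈ P.son₁.verts ∧ y ∈ P.son₁.verts)) : S = sonWith x y P := by
  rcases h with rfl | rfl
  · simp [sonWith, hx, hy]
  · rw [sonWith, if_neg (h2 rfl)]

theorem Elem.Nondegenerate.eq_of_mem_sons {P : Elem} (hP : P.Nondegenerate) {v : Plane}
    (h1 : v ∈ P.son₁.verts) (h2 : v ∈ P.son₂.verts) :
    v = midpoint ℝ P.left P.right ∨ v = P.apex := by
  rcases h1 with h | h | h
  · exact Or.inl h
  · exact Or.inr h
  · rcases h2 with h' | h' | h'
    · exact Or.inl h'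
    · exact Or.inr h'
    · exact absurd (h.symm.trans h') hP.left_ne_right

namespace IsAdmissible

variable {𝒯 : Mesh}

theorem refEdge_eq_of_isSon (h : IsAdmissible 𝒯) {P P' S : Elem} (hP : P ∈ 𝒯) (hP' : P' ∈ 𝒯)
    (hS : S.IsSon P') (hm : midpoint ℝ P.left P.right ∈ S.verts) : P.refEdge = P'.refEdge :=
  h.refEdge_eq_of_midpoint_mem hP hP' (hS.carrier_subset (S.verts_subset_carrier hm))

theorem card_edgeStar_bisectAll_of_midpoint (h : IsAdmissible 𝒯) {E : ℕ} (hE : 2 ≤ E)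
    (hcard : ∀ x y, x ≠ y → (edgeStar 𝒯 x y).card ≤ E) {P : Elem} (hP : P ∈ 𝒯) {y : Plane}
    (hy : y ≠ midpoint ℝ P.left P.right) :
    (edgeStar (AFEM.bisectAll 𝒯) (midpoint ℝ P.left P.right) y).card ≤ E := by
  by_cases hyP : y ∈ P.refEdge
  · refine ((Finset.card_le_card (t := (edgeStar 𝒯 P.left P.right).image
      (sonWith (midpoint ℝ P.left P.right) y)) fun S hS => ?_).trans Finset.card_image_le).trans
      (hcard P.left P.right (h.nondegenerate P hP).left_ne_right)
    obtain ⟨hS, hxS, hyS⟩ := mem_edgeStar.mp hS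
    obtain ⟨P', hP', hSP⟩ := mem_bisectAll.mp hS
    have he := h.refEdge_eq_of_isSon hP hP' hSP hxS
    have hsub : P.refEdge ⊆ P'.verts := he ▸ P'.refEdge_subset_verts
    refine Finset.mem_image.mpr ⟨P', mem_edgeStar.mpr ⟨hP', hsub (by simp [refEdge]),
      hsub (by simp [refEdge])⟩, (hSP.eq_sonWith hxS hyS ?_).symm⟩
    rintro rfl ⟨-, hy1⟩
    rcases (h.nondegenerate P' hP').eq_of_mem_sons hy1 hyS with hv | hv
    · exact hy (hv.trans (midpoint_eq_of_refEdge_eq he).symm)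
    · rw [he, hv] at hyP
      rcases hyP with hv | hv
      · exact (h.nondegenerate P' hP').apex_ne_left hv
      · exact (h.nondegenerate P' hP').apex_ne_right hv
  · -- If `y` is not on the refinement edge, it is the apex of the parent, which is thus unique.
    have key : ∀ S ∈ edgeStar (AFEM.bisectAll 𝒯) (midpoint ℝ P.left P.right) y,
        ∃ P' ∈ 𝒯, S.IsSon P' ∧ P.refEdge = P'.refEdge ∧ P'.apex = y := by
      intro S hS
      obtain ⟨hS, hxS, hyS⟩ := mem_edgeStar.mp hS
      obtain ⟨P', hP', hSP⟩ := mem_bisectAll.mp hS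
      have he := h.refEdge_eq_of_isSon hP hP' hSP hxS
      refine ⟨P', hP', hSP, he, ?_⟩
      rcases hSP.mem_verts hyS with hv | hv
      · exact absurd (hv.trans (midpoint_eq_of_refEdge_eq he).symm) hy
      · rcases hv with hv | hv
        · exact hv.symm
        · exact absurd (he ▸ hv) hyP
    rcases (edgeStar (AFEM.bisectAll 𝒯) (midpoint ℝ P.left P.right) y).eq_empty_or_nonempty
      with h0 | ⟨S₀, hS₀⟩
    · simp [h0]
    · obtain ⟨P₀, hP₀, -, he₀, ha₀⟩ := key S₀ hS₀
      refine le_trans (Finset.card_le_card (t := {P₀.son₁, P₀.son₂}) fun S hS => ?_)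
        (Finset.card_le_two.trans hE)
      obtain ⟨P', hP', hSP, he, ha⟩ := key S hS
      have : P' = P₀ := h.eq_of_refEdge_eq hP' hP₀ (he.symm.trans he₀) (ha.trans ha₀.symm)
      subst this
      rcases hSP with rfl | rfl <;> simp

/-- Uniform bisection does not increase the maximal number of elements at an edge, unless this
number is less than two. -/
theorem card_edgeStar_bisectAll (h : IsAdmissible 𝒯) {E : ℕ} (hE : 2 ≤ E)
    (hcard : ∀ x y, x ≠ y → (edgeStar 𝒯 x y).card ≤ E) {x y : Plane} (hxy : x ≠ y) :
    (edgeStar (AFEM.bisectAll 𝒯) x y).card ≤ E := by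
  by_cases hx : ∃ P ∈ 𝒯, x = midpoint ℝ P.left P.right
  · obtain ⟨P, hP, rfl⟩ := hx
    exact h.card_edgeStar_bisectAll_of_midpoint hE hcard hP hxy.symm
  by_cases hy : ∃ P ∈ 𝒯, y = midpoint ℝ P.left P.right
  · obtain ⟨P, hP, rfl⟩ := hy
    rw [edgeStar_comm]
    exact h.card_edgeStar_bisectAll_of_midpoint hE hcard hP hxy
  push Not at hx hy
  refine ((Finset.card_le_card (t := (edgeStar 𝒯 x y).image (sonWith x y)) fun S hS => ?_).trans
    Finset.card_image_le).trans (hcard x y hxy)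
  obtain ⟨hS, hxS, hyS⟩ := mem_edgeStar.mp hS
  obtain ⟨P, hP, hSP⟩ := mem_bisectAll.mp hS
  refine Finset.mem_image.mpr ⟨P, mem_edgeStar.mpr ⟨hP, (hSP.mem_verts hxS).resolve_left (hx P hP),
    (hSP.mem_verts hyS).resolve_left (hy P hP)⟩, (hSP.eq_sonWith hxS hyS ?_).symm⟩
  rintro rfl ⟨hx1, hy1⟩
  have nP := h.nondegenerate P hP
  have h1 := (nP.eq_of_mem_sons hx1 hxS).resolve_left (hx P hP)
  have h2 := (nP.eq_of_mem_sons hy1 hyS).resolve_left (hy P hP)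
  exact hxy (h1.trans h2.symm)

/-- Count the elements at a vertex, and count twice those whose angle at this vertex is divided by
the next bisection. This number does not change under uniform bisection once the vertex exists. -/
theorem card_vertexStar_bisectAll (h : IsAdmissible 𝒯) {E : ℕ}
    (hcard : ∀ x y, x ≠ y → (edgeStar 𝒯 x y).card ≤ E)
    (hstar : ∀ z, (edgeStar 𝒯 z z).card + (apexStar 𝒯 z).card ≤ 4 * E) (z : Plane) :
    (edgeStar (AFEM.bisectAll 𝒯) z z).card + (apexStar (AFEM.bisectAll 𝒯) z).card ≤ 4 * E := by
  have hsub : apexStar (AFEM.bisectAll 𝒯) z ⊆ edgeStar (AFEM.bisectAll 𝒯) z z := by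
    intro S hS
    obtain ⟨hS', rfl⟩ := mem_apexStar.mp hS
    exact mem_edgeStar.mpr ⟨hS', S.apex_mem_verts, S.apex_mem_verts⟩
  by_cases hz : ∃ P ∈ 𝒯, z = midpoint ℝ P.left P.right
  · obtain ⟨P, hP, rfl⟩ := hz
    have h1 := hcard P.left P.right (h.nondegenerate P hP).left_ne_right
    have h2 : (edgeStar (AFEM.bisectAll 𝒯) (midpoint ℝ P.left P.right)
        (midpoint ℝ P.left P.right)).card ≤ (edgeStar 𝒯 P.left P.right).card +
          (edgeStar 𝒯 P.left P.right).card := by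
      refine (Finset.card_le_card (t := (edgeStar 𝒯 P.left P.right).image son₁ ∪
        (edgeStar 𝒯 P.left P.right).image son₂) fun S hS => ?_).trans
        ((Finset.card_union_le _ _).trans (add_le_add Finset.card_image_le Finset.card_image_le))
      obtain ⟨hS, hxS, -⟩ := mem_edgeStar.mp hS
      obtain ⟨P', hP', hSP⟩ := mem_bisectAll.mp hS
      have he := h.refEdge_eq_of_isSon hP hP' hSP hxS
      have hsub : P.refEdge ⊆ P'.verts := he ▸ P'.refEdge_subset_verts
      have hmem : P' ∈ edgeStar 𝒯 P.left P.right := mem_edgeStar.mpr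
        ⟨hP', hsub (by simp [refEdge]), hsub (by simp [refEdge])⟩
      rw [Finset.mem_union]
      rcases hSP with rfl | rfl
      · exact Or.inl (Finset.mem_image_of_mem _ hmem)
      · exact Or.inr (Finset.mem_image_of_mem _ hmem)
    have h3 := Finset.card_le_card hsub
    omega
  · push Not at hz
    have h0 : apexStar (AFEM.bisectAll 𝒯) z = ∅ := by
      refine Finset.eq_empty_of_forall_notMem fun S hS => ?_
      obtain ⟨hS', rfl⟩ := mem_apexStar.mp hS
      obtain ⟨P, hP, rfl | rfl⟩ := mem_bisectAll.mp hS' <;> exact hz P hP rfl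
    rw [h0, Finset.card_empty, add_zero]
    refine le_trans ?_ (hstar z)
    refine (Finset.card_le_card (t := (edgeStar 𝒯 z z).image (sonWith z z) ∪
        (apexStar 𝒯 z).image son₂) fun S hS => ?_).trans
        ((Finset.card_union_le _ _).trans (add_le_add Finset.card_image_le Finset.card_image_le))
    obtain ⟨hS, hxS, -⟩ := mem_edgeStar.mp hS
    obtain ⟨P, hP, hSP⟩ := mem_bisectAll.mp hS
    have hzP := (hSP.mem_verts hxS).resolve_left (hz P hP)
    rw [Finset.mem_union]
    by_cases h2 : S = P.son₂ ∧ z ∈ P.son₁.verts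
    · obtain ⟨rfl, hz1⟩ := h2
      have ha := ((h.nondegenerate P hP).eq_of_mem_sons hz1 hxS).resolve_left (hz P hP)
      exact Or.inr (Finset.mem_image_of_mem _ (mem_apexStar.mpr ⟨hP, ha.symm⟩))
    · exact Or.inl (Finset.mem_image.mpr ⟨P, mem_edgeStar.mpr ⟨hP, hzP, hzP⟩,
        (hSP.eq_sonWith hxS hxS fun h3 h4 => h2 ⟨h3, h4.1⟩).symm⟩)

theorem card_edgeStar_uniformMesh (h : IsAdmissible 𝒯) (k : ℕ) {x y : Plane} (hxy : x ≠ y) :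
    (edgeStar (AFEM.uniformMesh 𝒯 k) x y).card ≤ max 𝒯.card 2 := by
  induction k generalizing x y with
  | zero => exact (card_edgeStar_le 𝒯 x y).trans (le_max_left _ _)
  | succ k ih =>
    exact (h.uniformMesh k).card_edgeStar_bisectAll (le_max_right _ _) (fun _ _ => ih) hxy

theorem card_vertexStar_uniformMesh (h : IsAdmissible 𝒯) (k : ℕ) (z : Plane) :
    (edgeStar (AFEM.uniformMesh 𝒯 k) z z).card + (apexStar (AFEM.uniformMesh 𝒯 k) z).card ≤
      4 * max 𝒯.card 2 := by
  induction k generalizing z with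
  | zero =>
    have h1 := card_edgeStar_le 𝒯 z z
    have h2 := card_apexStar_le 𝒯 z
    have := le_max_left 𝒯.card 2
    change (edgeStar 𝒯 z z).card + (apexStar 𝒯 z).card ≤ _
    omega
  | succ k ih =>
    exact (h.uniformMesh k).card_vertexStar_bisectAll
      (fun _ _ => h.card_edgeStar_uniformMesh k) ih z

end IsAdmissible

/-! ### Balls with respect to the touching relation -/

/-- Two elements touch if they have a common point. -/
def Elem.Touches (T T' : Elem) : Prop := (T.carrier ∩ T'.carrier).Nonempty

theorem Elem.Touches.symm {T T' : Elem} (h : T.Touches T') : T'.Touches T := by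
  rwa [Touches, Set.inter_comm]

theorem Elem.Touches.mono {T T' A A' : Elem} (h : T.Touches T') (hA : T.carrier ⊆ A.carrier)
    (hA' : T'.carrier ⊆ A'.carrier) : A.Touches A' :=
  Set.Nonempty.mono (Set.inter_subset_inter hA hA') h

theorem Elem.touches_of_mem {T T' : Elem} {x : Plane} (h : x ∈ T.carrier) (h' : x ∈ T'.carrier) :
    T.Touches T' := ⟨x, h, h'⟩

theorem Elem.Touches.refl (T : Elem) : T.Touches T :=
  touches_of_mem T.apex_mem_carrier T.apex_mem_carrier

open scoped Classical in
/-- The elements of `𝒯` that can be reached from `T` by a chain of `n` successively touching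
elements of `𝒯`. -/
def ball (𝒯 : Mesh) : ℕ → Elem → Finset Elem
  | 0, T => {T}
  | n + 1, T => (ball 𝒯 n T).biUnion fun S => {T' ∈ 𝒯 | S.Touches T'}

section Ball

variable {𝒯 : Mesh} {S T T' : Elem} {m n : ℕ}

theorem mem_ball_zero : T' ∈ ball 𝒯 0 T ↔ T' = T := by simp [ball]

theorem mem_ball_succ : T' ∈ ball 𝒯 (n + 1) T ↔ ∃ S ∈ ball 𝒯 n T, T' ∈ 𝒯 ∧ S.Touches T' := by
  simp [ball]

theorem mem_of_mem_ball (hT : T ∈ 𝒯) (h : T' ∈ ball 𝒯 n T) : T' ∈ 𝒯 := by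
  cases n with
  | zero => rwa [mem_ball_zero.mp h]
  | succ n =>
    obtain ⟨S, -, h, -⟩ := mem_ball_succ.mp h
    exact h

theorem ball_trans (h : S ∈ ball 𝒯 m T) (h' : T' ∈ ball 𝒯 n S) : T' ∈ ball 𝒯 (m + n) T := by
  induction n generalizing T' with
  | zero => rwa [mem_ball_zero.mp h']
  | succ n ih =>
    obtain ⟨R, hR, hT', hRT⟩ := mem_ball_succ.mp h'
    exact mem_ball_succ.mpr ⟨R, ih hR, hT', hRT⟩

theorem mem_ball_one (hT' : T' ∈ 𝒯) (h : T.Touches T') : T' ∈ ball 𝒯 1 T :=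
  mem_ball_succ.mpr ⟨T, mem_ball_zero.mpr rfl, hT', h⟩

theorem ball_symm (hT : T ∈ 𝒯) (h : T' ∈ ball 𝒯 n T) : T ∈ ball 𝒯 n T' := by
  induction n generalizing T' with
  | zero => rw [mem_ball_zero] at h ⊢; exact h.symm
  | succ n ih =>
    obtain ⟨R, hR, hT', hRT⟩ := mem_ball_succ.mp h
    rw [add_comm]
    exact ball_trans (mem_ball_one (mem_of_mem_ball hT hR) hRT.symm) (ih hR)

theorem self_mem_ball (hT : T ∈ 𝒯) : T ∈ ball 𝒯 n T := by
  induction n with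
  | zero => exact mem_ball_zero.mpr rfl
  | succ n ih => exact mem_ball_succ.mpr ⟨T, ih, hT, .refl T⟩

theorem ball_mono (hT : T ∈ 𝒯) (hmn : m ≤ n) (h : T' ∈ ball 𝒯 m T) : T' ∈ ball 𝒯 n T := by
  obtain ⟨d, rfl⟩ := Nat.exists_eq_add_of_le hmn
  exact ball_trans h (self_mem_ball (mem_of_mem_ball hT h))

open scoped Classical in
theorem IsAdmissible.card_ball_le (h : IsAdmissible 𝒯) {N : ℕ}
    (hN : ∀ z, (edgeStar 𝒯 z z).card ≤ N) (hT : T ∈ 𝒯) (n : ℕ) :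
    (ball 𝒯 n T).card ≤ (3 * N) ^ n := by
  induction n with
  | zero => simp [ball]
  | succ n ih =>
    rw [ball, pow_succ]
    refine (Finset.card_biUnion_le_card_mul _ _ (3 * N) fun S hS => ?_).trans
      (Nat.mul_le_mul_right _ ih)
    have hS' := mem_of_mem_ball hT hS
    have hsub : {T' ∈ 𝒯 | S.Touches T'} ⊆
        edgeStar 𝒯 S.apex S.apex ∪ (edgeStar 𝒯 S.left S.left ∪ edgeStar 𝒯 S.right S.right) := by
      intro T' hT'
      obtain ⟨hT', hST⟩ := Finset.mem_filter.mp hT'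
      rw [Touches, h.inter_carrier hS' hT', convexHull_nonempty_iff] at hST
      obtain ⟨v, hv, hv'⟩ := hST
      simp only [Finset.mem_union, mem_edgeStar]
      rcases hv with rfl | rfl | rfl <;> simp [hT', hv']
    refine (Finset.card_le_card hsub).trans ?_
    have h1 := Finset.card_union_le (edgeStar 𝒯 S.apex S.apex)
      (edgeStar 𝒯 S.left S.left ∪ edgeStar 𝒯 S.right S.right)
    have h2 := Finset.card_union_le (edgeStar 𝒯 S.left S.left) (edgeStar 𝒯 S.right S.right)
    have := hN S.apex
    have := hN S.left
    have := hN S.right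
    omega

end Ball

/-! ### Contraction of the touching distance under passage to ancestors -/

/-- `T` arises from `A` by `j` successive bisections. -/
def Elem.IsDesc : ℕ → Elem → Elem → Prop
  | 0, T, A => T = A
  | j + 1, T, A => ∃ B : Elem, T.IsSon B ∧ IsDesc j B A

theorem Elem.IsDesc.carrier_subset {j : ℕ} {T A : Elem} (h : IsDesc j T A) :
    T.carrier ⊆ A.carrier := by
  induction j generalizing T with
  | zero => obtain rfl := h; exact subset_rfl
  | succ j ih =>
    obtain ⟨B, hTB, hB⟩ := h
    exact hTB.carrier_subset.trans (ih hB)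

theorem Elem.IsDesc.mem_uniformMesh {𝒯 : Mesh} {j k : ℕ} {T A : Elem} (h : IsDesc j T A)
    (hA : A ∈ uniformMesh 𝒯 k) : T ∈ uniformMesh 𝒯 (k + j) := by
  induction j generalizing T with
  | zero => obtain rfl := h; exact hA
  | succ j ih =>
    obtain ⟨B, hTB, hB⟩ := h
    exact mem_uniformMesh_succ.mpr ⟨B, ih hB, hTB⟩

theorem exists_isDesc {𝒯 : Mesh} {j k : ℕ} {T : Elem} (hT : T ∈ uniformMesh 𝒯 (k + j)) :
    ∃ A ∈ uniformMesh 𝒯 k, IsDesc j T A := by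
  induction j generalizing T with
  | zero => exact ⟨T, hT, rfl⟩
  | succ j ih =>
    obtain ⟨B, hB, hTB⟩ := mem_uniformMesh_succ.mp hT
    obtain ⟨A, hA, hBA⟩ := ih hB
    exact ⟨A, hA, B, hTB, hBA⟩

theorem IsAdmissible.eq_of_isDesc {𝒯 : Mesh} (h : IsAdmissible 𝒯) {j k : ℕ} {T A A' : Elem}
    (hA : A ∈ AFEM.uniformMesh 𝒯 k) (hA' : A' ∈ AFEM.uniformMesh 𝒯 k) (hT : IsDesc j T A)
    (hT' : IsDesc j T A') : A = A' := by
  induction j generalizing T with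
  | zero => exact hT.symm.trans hT'
  | succ j ih =>
    obtain ⟨B, hTB, hB⟩ := hT
    obtain ⟨B', hTB', hB'⟩ := hT'
    obtain rfl := (h.uniformMesh (k + j)).eq_of_isSon (hB.mem_uniformMesh hA)
      (hB'.mem_uniformMesh hA') hTB hTB'
    exact ih hB hB'

theorem ball_of_isDesc {𝒯 : Mesh} (h : IsAdmissible 𝒯) {j k n : ℕ} {T S A B : Elem}
    (hA : A ∈ uniformMesh 𝒯 k) (hB : B ∈ uniformMesh 𝒯 k) (hTA : IsDesc j T A)
    (hSB : IsDesc j S B) (hTS : T ∈ ball (uniformMesh 𝒯 (k + j)) n S) :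
    A ∈ ball (uniformMesh 𝒯 k) n B := by
  induction n generalizing T A with
  | zero =>
    obtain rfl := mem_ball_zero.mp hTS
    exact mem_ball_zero.mpr (h.eq_of_isDesc hA hB hTA hSB)
  | succ n ih =>
    obtain ⟨R, hR, -, hRT⟩ := mem_ball_succ.mp hTS
    obtain ⟨C, hC, hRC⟩ := exists_isDesc (mem_of_mem_ball (hSB.mem_uniformMesh hB) hR)
    exact mem_ball_succ.mpr ⟨C, ih hC hRC hR, hA, hRT.mono hRC.carrier_subset hTA.carrier_subset⟩

/-- Three bisections halve the oscillation of affine functions. -/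
theorem Elem.IsDesc.sub_le_half {T A : Elem} (h : IsDesc 3 T A) {f : Plane →ᵃ[ℝ] ℝ}
    (hf : ∀ v ∈ A.verts, 0 ≤ f v ∧ f v ≤ 1) {x y : Plane} (hx : x ∈ T.carrier)
    (hy : y ∈ T.carrier) : f x - f y ≤ 1 / 2 := by
  have hv : ∀ v ∈ T.verts, ∀ w ∈ T.verts, f v - f w ≤ 1 / 2 := by
    obtain ⟨B, hTB, C, hBC, D, hCD, rfl⟩ := h
    have h1 := hf D.apex (by simp [verts])
    have h2 := hf D.left (by simp [verts])
    have h3 := hf D.right (by simp [verts])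
    rcases hCD with rfl | rfl <;> rcases hBC with rfl | rfl <;> rcases hTB with rfl | rfl <;>
      rintro v (rfl | rfl | rfl) w (rfl | rfl | rfl) <;>
      simp only [son₁, son₂, affine_midpoint] <;> linarith
  have h1 : ∀ w ∈ T.verts, f x - f w ≤ 1 / 2 := by
    intro w hw
    have := convexHull_min (t := {z | f z ≤ f w + 1 / 2})
      (fun v hv' => by change f v ≤ _; linarith [hv v hv' w hw])
      ((convex_Iic _).affine_preimage f) hx
    change f x ≤ _ at this
    linarith
  have := convexHull_min (t := {z | f x - 1 / 2 ≤ f z})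
    (fun v hv' => by change _ ≤ f v; linarith [h1 v hv'])
    ((convex_Ici _).affine_preimage f) hy
  change _ ≤ f y at this
  linarith

/-- A descendant of `A` after three bisections is so small that elements of the mesh of `A` that
it touches touch each other: it cannot meet two disjoint faces of `A`. -/
theorem IsAdmissible.touches_of_isDesc {𝒯 : Mesh} (h : IsAdmissible 𝒯) {A A₁ A₂ T : Elem}
    (hA : A ∈ 𝒯) (hA₁ : A₁ ∈ 𝒯) (hA₂ : A₂ ∈ 𝒯) (hT : IsDesc 3 T A) (h₁ : T.Touches A₁)
    (h₂ : T.Touches A₂) : A₁.Touches A₂ := by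
  obtain ⟨x, hxT, hx⟩ := h₁
  obtain ⟨y, hyT, hy⟩ := h₂
  have hxW : x ∈ convexHull ℝ (A.verts ∩ A₁.verts) := by
    rw [← h.inter_carrier hA hA₁]; exact ⟨hT.carrier_subset hxT, hx⟩
  have hyW : y ∈ convexHull ℝ (A.verts ∩ A₂.verts) := by
    rw [← h.inter_carrier hA hA₂]; exact ⟨hT.carrier_subset hyT, hy⟩
  by_contra hdis
  obtain ⟨f, hf⟩ := (h.nondegenerate A hA).exists_indicator A₁.verts
  have hfx : f x = 0 := affine_eq_of_mem_convexHull (fun v hv => (hf v hv.1).1 hv.2) hxW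
  have hfy : f y = 1 := affine_eq_of_mem_convexHull (fun v hv => (hf v hv.1).2 fun hv' =>
    hdis (touches_of_mem (A₁.verts_subset_carrier hv') (A₂.verts_subset_carrier hv.2))) hyW
  have := hT.sub_le_half (f := f) (fun v hv => by
    by_cases hv' : v ∈ A₁.verts
    · rw [(hf v hv).1 hv']; norm_num
    · rw [(hf v hv).2 hv']; norm_num) hyT hxT
  rw [hfx, hfy] at this
  norm_num at this

theorem ball_of_isDesc_three {𝒯 : Mesh} (h : IsAdmissible 𝒯) {k n : ℕ} {T S A B : Elem}
    (hA : A ∈ uniformMesh 𝒯 k) (hB : B ∈ uniformMesh 𝒯 k) (hTA : IsDesc 3 T A)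
    (hSB : IsDesc 3 S B) (hTS : T ∈ ball (uniformMesh 𝒯 (k + 3)) (2 * n) S) :
    A ∈ ball (uniformMesh 𝒯 k) n B := by
  induction n generalizing T A with
  | zero => exact ball_of_isDesc h hA hB hTA hSB hTS
  | succ n ih =>
    obtain ⟨R, hR, hRm, hRT⟩ := mem_ball_succ.mp (show T ∈ ball _ (2 * n + 1 + 1) S from hTS)
    obtain ⟨Q, hQ, hRm, hQR⟩ := mem_ball_succ.mp hR
    obtain ⟨C, hC, hRC⟩ := exists_isDesc hRm
    obtain ⟨E, hE, hQE⟩ := exists_isDesc (mem_of_mem_ball (hSB.mem_uniformMesh hB) hQ)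
    exact mem_ball_succ.mpr ⟨E, ih hE hQE hQ, hA, (h.uniformMesh k).touches_of_isDesc hC hE hA hRC
      (hQR.symm.mono subset_rfl hQE.carrier_subset) (hRT.mono subset_rfl hTA.carrier_subset)⟩

/-! ### Refinement trees -/

/-- An admissible mesh whose elements have level zero. -/
structure IsRootMesh (𝒯₀ : Mesh) : Prop extends IsAdmissible 𝒯₀ where
  level_eq_zero : ∀ T ∈ 𝒯₀, T.level = 0

/-- A finite set of nodes of the infinite binary forest over `𝒯₀` generated by bisection that
contains with a node all its ancestors. These are the possible sets of bisected elements. -/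
structure IsTree (𝒯₀ I : Mesh) : Prop where
  exists_mem_uniformMesh : ∀ T ∈ I, ∃ k, T ∈ uniformMesh 𝒯₀ k
  parent_mem : ∀ k, ∀ P ∈ uniformMesh 𝒯₀ k, ∀ S ∈ I, S.IsSon P → P ∈ I

/-- The mesh that arises from `𝒯₀` by bisection of the elements of the tree `I`. -/
def leaves (𝒯₀ I : Mesh) : Mesh := (𝒯₀ ∪ bisectAll I) \ I

theorem mem_leaves {𝒯₀ I : Mesh} {T : Elem} :
    T ∈ leaves 𝒯₀ I ↔ (T ∈ 𝒯₀ ∨ ∃ P ∈ I, T.IsSon P) ∧ T ∉ I := by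
  rw [leaves, Finset.mem_sdiff, Finset.mem_union, mem_bisectAll]

namespace IsRootMesh

variable {𝒯₀ I I' : Mesh} {j k : ℕ} {P P' S T : Elem}

theorem level_eq (h : IsRootMesh 𝒯₀) (hT : T ∈ AFEM.uniformMesh 𝒯₀ k) : T.level = k := by
  induction k generalizing T with
  | zero => exact h.level_eq_zero T hT
  | succ k ih =>
    obtain ⟨P, hP, hTP⟩ := mem_uniformMesh_succ.mp hT
    rw [hTP.level_eq, ih hP]

theorem parent_unique (h : IsRootMesh 𝒯₀) (hP : P ∈ AFEM.uniformMesh 𝒯₀ j)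
    (hP' : P' ∈ AFEM.uniformMesh 𝒯₀ k) (hS : S.IsSon P) (hS' : S.IsSon P') : P = P' := by
  have h1 := hS.level_eq
  have h2 := hS'.level_eq
  rw [h.level_eq hP] at h1
  rw [h.level_eq hP'] at h2
  obtain rfl : j = k := by omega
  exact (h.uniformMesh j).eq_of_isSon hP hP' hS hS'

theorem notMem_of_isSon (h : IsRootMesh 𝒯₀) (hS : S.IsSon P) : S ∉ 𝒯₀ := by
  intro hmem
  have := hS.level_eq
  rw [h.level_eq_zero S hmem] at this
  omega

theorem mem_uniformMesh_of_mem_leaves (hI : IsTree 𝒯₀ I) (hT : T ∈ leaves 𝒯₀ I) :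
    ∃ k, T ∈ AFEM.uniformMesh 𝒯₀ k := by
  rcases (mem_leaves.mp hT).1 with h0 | ⟨P, hP, hTP⟩
  · exact ⟨0, h0⟩
  · obtain ⟨k, hk⟩ := hI.exists_mem_uniformMesh P hP
    exact ⟨k + 1, mem_uniformMesh_succ.mpr ⟨P, hk, hTP⟩⟩

theorem mem_uniformMesh_level (h : IsRootMesh 𝒯₀) (hI : IsTree 𝒯₀ I) (hT : T ∈ leaves 𝒯₀ I) :
    T ∈ AFEM.uniformMesh 𝒯₀ T.level := by
  obtain ⟨k, hk⟩ := mem_uniformMesh_of_mem_leaves hI hT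
  rwa [h.level_eq hk]

theorem tree_subset (hI : IsTree 𝒯₀ I) : I ⊆ 𝒯₀ ∪ AFEM.bisectAll I := by
  intro T hT
  rw [Finset.mem_union, mem_bisectAll]
  obtain ⟨k, hk⟩ := hI.exists_mem_uniformMesh T hT
  cases k with
  | zero => exact Or.inl hk
  | succ k =>
    obtain ⟨P, hP, hTP⟩ := mem_uniformMesh_succ.mp hk
    exact Or.inr ⟨P, hI.parent_mem k P hP T hT hTP, hTP⟩

theorem card_leaves (h : IsRootMesh 𝒯₀) (hI : IsTree 𝒯₀ I) :
    (leaves 𝒯₀ I).card = 𝒯₀.card + I.card := by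
  have hparent : ∀ P ∈ I, ∀ P' ∈ I, ∀ S : Elem, S.IsSon P → S.IsSon P' → P = P' := by
    intro P hP P' hP' S hS hS'
    obtain ⟨j, hj⟩ := hI.exists_mem_uniformMesh P hP
    obtain ⟨k, hk⟩ := hI.exists_mem_uniformMesh P' hP'
    exact h.parent_unique hj hk hS hS'
  have h1 : (I.image son₁).card = I.card := Finset.card_image_of_injOn fun P hP P' hP' he =>
    hparent P hP P' hP' P.son₁ (Or.inl rfl) (Or.inl he)
  have h2 : (I.image son₂).card = I.card := Finset.card_image_of_injOn fun P hP P' hP' he =>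
    hparent P hP P' hP' P.son₂ (Or.inr rfl) (Or.inr he)
  have h3 : Disjoint (I.image son₁) (I.image son₂) := by
    rw [Finset.disjoint_left]
    intro S hS hS'
    obtain ⟨P, hP, rfl⟩ := Finset.mem_image.mp hS
    obtain ⟨P', hP', he⟩ := Finset.mem_image.mp hS'
    obtain rfl := hparent P hP P' hP' P.son₁ (Or.inl rfl) (Or.inr he.symm)
    obtain ⟨k, hk⟩ := hI.exists_mem_uniformMesh P hP
    exact ((h.uniformMesh k).nondegenerate P hk).son₁_ne_son₂ he.symm
  have h4 : Disjoint 𝒯₀ (AFEM.bisectAll I) := by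
    rw [Finset.disjoint_right]
    intro S hS
    obtain ⟨P, -, hSP⟩ := mem_bisectAll.mp hS
    exact h.notMem_of_isSon hSP
  rw [leaves, Finset.card_sdiff_of_subset (tree_subset hI), Finset.card_union_of_disjoint h4,
    AFEM.bisectAll, Finset.card_union_of_disjoint h3, h1, h2]
  omega

theorem isTree_insert (h : IsRootMesh 𝒯₀) (hI : IsTree 𝒯₀ I) (hT : T ∈ leaves 𝒯₀ I) :
    IsTree 𝒯₀ (insert T I) where
  exists_mem_uniformMesh S hS := by
    rcases Finset.mem_insert.mp hS with rfl | hS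
    · exact mem_uniformMesh_of_mem_leaves hI hT
    · exact hI.exists_mem_uniformMesh S hS
  parent_mem k P hP S hS hSP := by
    rcases Finset.mem_insert.mp hS with rfl | hS
    · rcases (mem_leaves.mp hT).1 with h0 | ⟨P', hP', hSP'⟩
      · exact absurd h0 (h.notMem_of_isSon hSP)
      · obtain ⟨j, hj⟩ := hI.exists_mem_uniformMesh P' hP'
        rw [h.parent_unique hP hj hSP hSP']
        exact Finset.mem_insert_of_mem hP'
    · exact Finset.mem_insert_of_mem (hI.parent_mem k P hP S hS hSP)

theorem leaves_insert (hI : IsTree 𝒯₀ I) (hT : T ∈ leaves 𝒯₀ I) :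
    leaves 𝒯₀ (insert T I) = (leaves 𝒯₀ I).erase T ∪ {T.son₁, T.son₂} := by
  obtain ⟨k, hk⟩ := mem_uniformMesh_of_mem_leaves hI hT
  have hTI := (mem_leaves.mp hT).2
  have hson : ∀ S : Elem, S.IsSon T → S ≠ T ∧ S ∉ I := by
    intro S hS
    refine ⟨?_, fun hSI => hTI (hI.parent_mem k T hk S hSI hS)⟩
    rintro rfl
    have := hS.level_eq
    omega
  ext S
  have hS : S.IsSon T ↔ S ∈ ({T.son₁, T.son₂} : Finset Elem) := by simp [IsSon]
  rw [Finset.mem_union, Finset.mem_erase, ← hS, mem_leaves, mem_leaves, Finset.mem_insert]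
  constructor
  · rintro ⟨h0 | ⟨P, hP, hSP⟩, hn⟩
    · exact Or.inl ⟨fun he => hn (Or.inl he), Or.inl h0, fun he => hn (Or.inr he)⟩
    · rcases Finset.mem_insert.mp hP with rfl | hP
      · exact Or.inr hSP
      · exact Or.inl ⟨fun he => hn (Or.inl he), Or.inr ⟨P, hP, hSP⟩, fun he => hn (Or.inr he)⟩
  · rintro (⟨hne, h0 | ⟨P, hP, hSP⟩, hn⟩ | hST)
    · exact ⟨Or.inl h0, by rintro (he | he); exacts [hne he, hn he]⟩
    · exact ⟨Or.inr ⟨P, Finset.mem_insert_of_mem hP, hSP⟩,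
        by rintro (he | he); exacts [hne he, hn he]⟩
    · exact ⟨Or.inr ⟨T, Finset.mem_insert_self _ _, hST⟩,
        by rintro (he | he); exacts [(hson S hST).1 he, (hson S hST).2 he]⟩

theorem isTree_empty : IsTree 𝒯₀ ∅ := ⟨by simp, by simp⟩

theorem leaves_empty : leaves 𝒯₀ ∅ = 𝒯₀ := by simp [leaves, AFEM.bisectAll]

theorem exists_tree (h : IsRootMesh 𝒯₀) {𝒯 : Mesh}
    (h𝒯 : Relation.ReflTransGen BisectStep 𝒯₀ 𝒯) : ∃ I, IsTree 𝒯₀ I ∧ 𝒯 = leaves 𝒯₀ I := by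
  induction h𝒯 with
  | refl => exact ⟨∅, isTree_empty, leaves_empty.symm⟩
  | tail _ hstep ih =>
    obtain ⟨I, hI, rfl⟩ := ih
    obtain ⟨T, hT, rfl⟩ := hstep
    exact ⟨insert T I, h.isTree_insert hI hT, (leaves_insert hI hT).symm⟩

theorem reflTransGen_leaves (h : IsRootMesh 𝒯₀) (hI : IsTree 𝒯₀ I) (hI' : IsTree 𝒯₀ I')
    (hII' : I ⊆ I') : Relation.ReflTransGen BisectStep (leaves 𝒯₀ I) (leaves 𝒯₀ I') := by
  induction hn : (I' \ I).card generalizing I with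
  | zero =>
    have : I' ⊆ I := by rwa [Finset.card_eq_zero, Finset.sdiff_eq_empty_iff_subset] at hn
    rw [hII'.antisymm this]
  | succ n ih =>
    have hne : (I' \ I).Nonempty := by rw [← Finset.card_pos]; omega
    -- A missing node of minimal level is a leaf of the smaller tree.
    obtain ⟨T, hT, hmin⟩ := Finset.exists_min_image (I' \ I) Elem.level hne
    obtain ⟨hTI', hTI⟩ := Finset.mem_sdiff.mp hT
    have hleaf : T ∈ leaves 𝒯₀ I := by
      refine mem_leaves.mpr ⟨?_, hTI⟩
      obtain ⟨k, hk⟩ := hI'.exists_mem_uniformMesh T hTI'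
      cases k with
      | zero => exact Or.inl hk
      | succ k =>
        obtain ⟨P, hP, hTP⟩ := mem_uniformMesh_succ.mp hk
        refine Or.inr ⟨P, by_contra fun hPI => ?_, hTP⟩
        have := hmin P (Finset.mem_sdiff.mpr ⟨hI'.parent_mem k P hP T hTI' hTP, hPI⟩)
        have := hTP.level_eq
        omega
    refine Relation.ReflTransGen.head (b := leaves 𝒯₀ (insert T I))
      ⟨T, hleaf, leaves_insert hI hleaf⟩ ?_
    refine ih (h.isTree_insert hI hleaf) (Finset.insert_subset hTI' hII') ?_
    have he : I' \ insert T I = (I' \ I).erase T := by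
      ext S; simp only [Finset.mem_sdiff, Finset.mem_insert, Finset.mem_erase]; tauto
    rw [he, Finset.card_erase_of_mem hT, hn]
    rfl

/-- Every node of a tree has an ancestor of each lower level in the tree. -/
theorem exists_ancestor (hI : IsTree 𝒯₀ I) (hT : T ∈ AFEM.uniformMesh 𝒯₀ (k + j)) (hTI : T ∈ I) :
    ∃ A ∈ AFEM.uniformMesh 𝒯₀ k, A ∈ I ∧ T.carrier ⊆ A.carrier := by
  induction j generalizing T with
  | zero => exact ⟨T, hT, hTI, subset_rfl⟩
  | succ j ih =>
    obtain ⟨B, hB, hTB⟩ := mem_uniformMesh_succ.mp hT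
    obtain ⟨A, hA, hAI, hBA⟩ := ih hB (hI.parent_mem _ B hB T hTI hTB)
    exact ⟨A, hA, hAI, hTB.carrier_subset.trans hBA⟩

end IsRootMesh

/-! ### The graded closure of a tree -/

/-- The nodes of level `k` in the smallest family of nodes that contains the `m`-balls around the
nodes in `I` and the `m`-balls around the parents of its members, where balls are taken in the
uniform mesh of the respective level. -/
inductive Near (𝒯₀ I : Mesh) (m : ℕ) : ℕ → Elem → Prop
  | base {k : ℕ} {S T : Elem} (hSI : S ∈ I) (hS : S ∈ uniformMesh 𝒯₀ k)
      (hT : T ∈ ball (uniformMesh 𝒯₀ k) m S) : Near 𝒯₀ I m k T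
  | step {k : ℕ} {T P T' : Elem} (hT : Near 𝒯₀ I m (k + 1) T) (hP : P ∈ uniformMesh 𝒯₀ k)
      (hTP : T.IsSon P) (hT' : T' ∈ ball (uniformMesh 𝒯₀ k) m P) : Near 𝒯₀ I m k T'

variable {𝒯₀ I : Mesh} {m k : ℕ}

theorem Near.mem_uniformMesh {T : Elem} (h : Near 𝒯₀ I m k T) : T ∈ uniformMesh 𝒯₀ k := by
  cases h with
  | base _ hS hT => exact mem_of_mem_ball hS hT
  | step _ hP _ hT' => exact mem_of_mem_ball hP hT'

theorem isDesc_one {T P : Elem} (h : T.IsSon P) : IsDesc 1 T P := ⟨P, h, rfl⟩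

/-- The family `Near` stays close to `I`. Passing to the parents costs `m` in every generation,
but three generations halve the distance, so that the distance `6 * m` is never exceeded. -/
theorem Near.exists_mem (h : IsRootMesh 𝒯₀) (hI : IsTree 𝒯₀ I) {T : Elem}
    (hT : Near 𝒯₀ I m k T) :
    ∃ S ∈ I, S ∈ uniformMesh 𝒯₀ k ∧ T ∈ ball (uniformMesh 𝒯₀ k) (2 * (3 * m)) S ∧
      (∀ i P Q, k = i + 1 → P ∈ uniformMesh 𝒯₀ i → Q ∈ uniformMesh 𝒯₀ i → IsDesc 1 T P →
        IsDesc 1 S Q → P ∈ ball (uniformMesh 𝒯₀ i) (5 * m) Q) ∧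
      (∀ i P Q, k = i + 2 → P ∈ uniformMesh 𝒯₀ i → Q ∈ uniformMesh 𝒯₀ i → IsDesc 2 T P →
        IsDesc 2 S Q → P ∈ ball (uniformMesh 𝒯₀ i) (4 * m) Q) := by
  induction hT with
  | @base k S T hSI hS hT =>
    refine ⟨S, hSI, hS, ball_mono hS (by omega) hT, ?_, ?_⟩
    · rintro i P Q rfl hP hQ hTP hSQ
      exact ball_mono hQ (by omega) (ball_of_isDesc h.toIsAdmissible hP hQ hTP hSQ hT)
    · rintro i P Q rfl hP hQ hTP hSQ
      exact ball_mono hQ (by omega) (ball_of_isDesc h.toIsAdmissible hP hQ hTP hSQ hT)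
  | @step k T P T' _ hP hTP hT' ih =>
    obtain ⟨S, hSI, hS, hTS, hTS₁, hTS₂⟩ := ih
    obtain ⟨Q, hQ, hSQ⟩ := mem_uniformMesh_succ.mp hS
    refine ⟨Q, hI.parent_mem k Q hQ S hSI hSQ, hQ, ?_, ?_, ?_⟩
    · exact ball_mono hQ (by omega)
        (ball_trans (hTS₁ k P Q rfl hP hQ (isDesc_one hTP) (isDesc_one hSQ)) hT')
    · rintro i P' Q' rfl hP' hQ' hTP' hSQ'
      obtain ⟨R, hR, hPR⟩ := exists_isDesc (j := 1) hP
      have h1 := ball_of_isDesc h.toIsAdmissible hP' hR hTP' hPR hT'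
      have h2 := hTS₂ i R Q' rfl hR hQ' ⟨P, hTP, hPR⟩ ⟨Q, hSQ, hSQ'⟩
      exact ball_mono hQ' (by omega) (ball_trans h2 h1)
    · rintro i P' Q' rfl hP' hQ' hTP' hSQ'
      obtain ⟨R, hR, hPR⟩ := exists_isDesc (j := 2) hP
      have h1 := ball_of_isDesc h.toIsAdmissible hP' hR hTP' hPR hT'
      have h2 := ball_of_isDesc_three h.toIsAdmissible hR hQ' (T := T) (S := S)
        ⟨P, hTP, hPR⟩ ⟨Q, hSQ, hSQ'⟩ hTS
      exact ball_mono hQ' (by omega) (ball_trans h2 h1)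

open scoped Classical in
/-- The tree of all nodes that share their refinement edge with a node in `Near 𝒯₀ I m`. It is
realized as a subset of the union of large balls around the nodes in `I`. -/
def closureTree (𝒯₀ : Mesh) (m : ℕ) (I : Mesh) : Mesh :=
  {T ∈ I.biUnion fun S => ball (uniformMesh 𝒯₀ S.level) (2 * (3 * m) + 1) S |
    ∃ k R, Near 𝒯₀ I m k R ∧ T ∈ uniformMesh 𝒯₀ k ∧ T.refEdge = R.refEdge}

theorem touches_of_refEdge_eq {T T' : Elem} (h : T.refEdge = T'.refEdge) : T.Touches T' := by
  have hl : T.left ∈ T.refEdge := by simp [refEdge]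
  exact touches_of_mem (T.verts_subset_carrier (T.refEdge_subset_verts hl))
    (T'.verts_subset_carrier (T'.refEdge_subset_verts (h ▸ hl)))

namespace IsRootMesh

theorem mem_closureTree (h : IsRootMesh 𝒯₀) (hI : IsTree 𝒯₀ I) {T : Elem} :
    T ∈ closureTree 𝒯₀ m I ↔
      ∃ k R, Near 𝒯₀ I m k R ∧ T ∈ AFEM.uniformMesh 𝒯₀ k ∧ T.refEdge = R.refEdge := by
  classical
  rw [closureTree, Finset.mem_filter, and_iff_right_iff_imp]
  rintro ⟨k, R, hR, hT, hTR⟩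
  obtain ⟨S, hSI, hS, hRS, -⟩ := hR.exists_mem h hI
  refine Finset.mem_biUnion.mpr ⟨S, hSI, ?_⟩
  rw [h.level_eq hS]
  exact mem_ball_succ.mpr ⟨R, hRS, hT, touches_of_refEdge_eq hTR.symm⟩

theorem card_closureTree_le (h : IsRootMesh 𝒯₀) (hI : IsTree 𝒯₀ I) (m : ℕ) :
    (closureTree 𝒯₀ m I).card ≤ (3 * (4 * max 𝒯₀.card 2)) ^ (2 * (3 * m) + 1) * I.card := by
  classical
  refine (Finset.card_filter_le _ _).trans ?_
  rw [mul_comm _ I.card]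
  refine Finset.card_biUnion_le_card_mul _ _ _ fun S hS => ?_
  obtain ⟨k, hk⟩ := hI.exists_mem_uniformMesh S hS
  rw [h.level_eq hk]
  exact (h.uniformMesh k).card_ball_le
    (fun z => le_of_add_le_left (h.card_vertexStar_uniformMesh k z)) hk _

theorem subset_closureTree (h : IsRootMesh 𝒯₀) (hI : IsTree 𝒯₀ I) : I ⊆ closureTree 𝒯₀ m I := by
  intro T hT
  obtain ⟨k, hk⟩ := hI.exists_mem_uniformMesh T hT
  exact (h.mem_closureTree hI).mpr ⟨k, T, .base hT hk (self_mem_ball hk), hk, rfl⟩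

theorem isTree_closureTree (h : IsRootMesh 𝒯₀) (hI : IsTree 𝒯₀ I) (hm : 1 ≤ m) :
    IsTree 𝒯₀ (closureTree 𝒯₀ m I) where
  exists_mem_uniformMesh T hT := by
    obtain ⟨k, R, -, hT, -⟩ := (h.mem_closureTree hI).mp hT
    exact ⟨k, hT⟩
  parent_mem k P hP T hT hTP := by
    obtain ⟨j, R, hR, hT, hTR⟩ := (h.mem_closureTree hI).mp hT
    have hj := hTP.level_eq
    rw [h.level_eq hP, h.level_eq hT] at hj
    subst hj
    obtain ⟨Q, hQ, hRQ⟩ := mem_uniformMesh_succ.mp hR.mem_uniformMesh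
    refine (h.mem_closureTree hI).mpr ⟨k, P, .step hR hQ hRQ ?_, hP, rfl⟩
    exact ball_mono hQ hm (mem_ball_one hP
      ((touches_of_refEdge_eq hTR.symm).mono hRQ.carrier_subset hTP.carrier_subset))

/-- Two points of an element of level at least `k - 1` belong to touching elements of level `k`. -/
theorem exists_touching_cover {j : ℕ} {R : Elem} (hR : R ∈ AFEM.uniformMesh 𝒯₀ j) (hkj : k ≤ j + 1)
    {p q : Plane} (hp : p ∈ R.carrier) (hq : q ∈ R.carrier) :
    ∃ B ∈ AFEM.uniformMesh 𝒯₀ k, ∃ B' ∈ AFEM.uniformMesh 𝒯₀ k,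
      p ∈ B.carrier ∧ q ∈ B'.carrier ∧ B.Touches B' := by
  rcases Nat.lt_or_ge j k with hlt | hle
  · obtain rfl : k = j + 1 := by omega
    have key : ∀ x ∈ R.carrier, ∃ B : Elem, B.IsSon R ∧ x ∈ B.carrier := by
      intro x hx
      rcases carrier_subset_sons hx with hx | hx
      exacts [⟨_, Or.inl rfl, hx⟩, ⟨_, Or.inr rfl, hx⟩]
    have hapex : ∀ B : Elem, B.IsSon R → midpoint ℝ R.left R.right ∈ B.carrier := by
      rintro B (rfl | rfl)
      exacts [R.son₁.apex_mem_carrier, R.son₂.apex_mem_carrier]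
    obtain ⟨B, hB, hpB⟩ := key p hp
    obtain ⟨B', hB', hqB'⟩ := key q hq
    exact ⟨B, mem_uniformMesh_succ.mpr ⟨R, hR, hB⟩, B', mem_uniformMesh_succ.mpr ⟨R, hR, hB'⟩,
      hpB, hqB', touches_of_mem (hapex B hB) (hapex B' hB')⟩
  · obtain ⟨i, rfl⟩ := Nat.exists_eq_add_of_le hle
    obtain ⟨A, hA, hRA⟩ := exists_isDesc hR
    exact ⟨A, hA, A, hA, hRA.carrier_subset hp, hRA.carrier_subset hq, .refl A⟩

/-- A chain of elements of level at least `k - 1` in a mesh of leaves is shadowed by a chain of at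
most twice the length in the uniform mesh of level `k`. -/
theorem exists_shadow (h : IsRootMesh 𝒯₀) (hI : IsTree 𝒯₀ I) {T R : Elem}
    (hT : T ∈ AFEM.uniformMesh 𝒯₀ k) {n : ℕ}
    (hlevel : ∀ i ≤ n, ∀ Q ∈ ball (leaves 𝒯₀ I) i T, k ≤ Q.level + 1)
    (hR : R ∈ ball (leaves 𝒯₀ I) n T) {p : Plane} (hp : p ∈ R.carrier) :
    ∃ B ∈ AFEM.uniformMesh 𝒯₀ k, p ∈ B.carrier ∧
      B ∈ ball (AFEM.uniformMesh 𝒯₀ k) (2 * n) T := by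
  induction n generalizing R p with
  | zero =>
    obtain rfl := mem_ball_zero.mp hR
    exact ⟨R, hT, hp, mem_ball_zero.mpr rfl⟩
  | succ n ih =>
    have hRk := hlevel (n + 1) le_rfl R hR
    obtain ⟨Q, hQ, hRL, q, hqQ, hqR⟩ := mem_ball_succ.mp hR
    obtain ⟨B, hB, hqB, hBT⟩ := ih (fun i hi => hlevel i (by omega)) hQ hqQ
    obtain ⟨B', hB', B'', hB'', hq', hp', ht⟩ :=
      exists_touching_cover (h.mem_uniformMesh_level hI hRL) hRk hqR hp
    exact ⟨B'', hB'', hp', mem_ball_succ.mpr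
      ⟨B', mem_ball_succ.mpr ⟨B, hBT, hB', touches_of_mem hqB hq'⟩, hB'', ht⟩⟩

/-- In the mesh of leaves of the closure, levels change by at most one along short chains. -/
theorem level_le_of_mem_ball (h : IsRootMesh 𝒯₀) (hI : IsTree 𝒯₀ I) {n : ℕ} (hm : 1 ≤ m)
    (hn : 2 * n ≤ m) {T T' : Elem} (hT : T ∈ leaves 𝒯₀ (closureTree 𝒯₀ m I))
    (hT' : T' ∈ ball (leaves 𝒯₀ (closureTree 𝒯₀ m I)) n T) : T'.level ≤ T.level + 1 := by
  induction n using Nat.strong_induction_on generalizing T T' with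
  | _ n ih =>
  have hJ := h.isTree_closureTree hI hm
  by_contra! hlt
  cases n with
  | zero =>
    obtain rfl := mem_ball_zero.mp hT'
    omega
  | succ n =>
    obtain ⟨R, hR, hT'L, p, hpR, hpT'⟩ := mem_ball_succ.mp hT'
    have hTk := h.mem_uniformMesh_level hJ hT
    obtain ⟨B, hB, hpB, hBT⟩ := h.exists_shadow hJ hTk (fun i hi Q hQ =>
      ih i (by omega) (by omega) (mem_of_mem_ball hT hQ) (ball_symm hT hQ)) hR hpR
    -- An ancestor `A` of `T'` of level `T.level + 1` belongs to the tree. Its parent is so close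
    -- to `T` that `T` belongs to the tree as well.
    obtain ⟨A, hA, hAJ, hpA⟩ : ∃ A ∈ AFEM.uniformMesh 𝒯₀ (T.level + 1),
        A ∈ closureTree 𝒯₀ m I ∧ p ∈ A.carrier := by
      rcases (mem_leaves.mp hT'L).1 with h0 | ⟨P, hP, hTP⟩
      · have := h.level_eq_zero T' h0
        omega
      · obtain ⟨j, hj⟩ := hJ.exists_mem_uniformMesh P hP
        have h1 := hTP.level_eq
        rw [h.level_eq hj] at h1
        obtain ⟨d, rfl⟩ := Nat.exists_eq_add_of_le (show T.level + 1 ≤ j by omega)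
        obtain ⟨A, hA, hAJ, hPA⟩ := exists_ancestor hJ hj hP
        exact ⟨A, hA, hAJ, hPA (hTP.carrier_subset hpT')⟩
    obtain ⟨j, S, hS, hAj, hAS⟩ := (h.mem_closureTree hI).mp hAJ
    obtain rfl : j = T.level + 1 := by rw [← h.level_eq hAj, h.level_eq hA]
    obtain ⟨P, hP, hAP⟩ := mem_uniformMesh_succ.mp hA
    obtain ⟨Q, hQ, hSQ⟩ := mem_uniformMesh_succ.mp hS.mem_uniformMesh
    have hQT : Q ∈ ball (AFEM.uniformMesh 𝒯₀ T.level) (2 * n + 1 + 1) T :=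
      mem_ball_succ.mpr ⟨P, mem_ball_succ.mpr
        ⟨B, hBT, hP, touches_of_mem hpB (hAP.carrier_subset hpA)⟩, hQ,
        (touches_of_refEdge_eq hAS).mono hAP.carrier_subset hSQ.carrier_subset⟩
    refine (mem_leaves.mp hT).2 ((h.mem_closureTree hI).mpr ⟨T.level, T, ?_, hTk, rfl⟩)
    exact .step hS hQ hSQ (ball_mono hQ (by omega) (ball_symm hTk hQT))

/-- Conformity of two leaves with successive levels: the refinement edge of the parent of the finer
leaf is not an edge of the coarser leaf, which would otherwise belong to the tree. -/
theorem conforming_of_level_succ (h : IsRootMesh 𝒯₀) (hI : IsTree 𝒯₀ I) {P T T' : Elem}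
    (hP : P ∈ closureTree 𝒯₀ m I) (hPk : P ∈ AFEM.uniformMesh 𝒯₀ k) (hTP : T.IsSon P)
    (hT' : T' ∈ AFEM.uniformMesh 𝒯₀ k) (hT'J : T' ∉ closureTree 𝒯₀ m I) :
    T.verts ≠ T'.verts ∧ T.carrier ∩ T'.carrier = convexHull ℝ (T.verts ∩ T'.verts) := by
  have hk := h.uniformMesh k
  have hE : P.refEdge ≠ T'.refEdge := by
    intro he
    obtain ⟨j, R, hR, hPj, hPR⟩ := (h.mem_closureTree hI).mp hP
    obtain rfl : j = k := by rw [← h.level_eq hPj, h.level_eq hPk]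
    exact hT'J ((h.mem_closureTree hI).mpr ⟨j, R, hR, hT', he.symm.trans hPR⟩)
  constructor
  · intro hv
    have hm : midpoint ℝ P.left P.right ∈ T'.verts := by
      rw [← hv]
      rcases hTP with rfl | rfl <;> simp [verts, son₁, son₂]
    exact hk.midpoint_notMem_verts hPk hT' hm
  · refine inter_carrier_eq_of_subset ?_
    rintro x ⟨hx, hx'⟩
    have hxW : x ∈ convexHull ℝ (P.verts ∩ T'.verts) := by
      rw [← hk.inter_carrier hPk hT']; exact ⟨hTP.carrier_subset hx, hx'⟩
    refine convexHull_mono ?_ (hTP.inter_face (hk.nondegenerate P hPk) Set.inter_subset_left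
      (fun hs => hE (hk.matching P hPk T' hT' fun v hv => (hs hv).2)) hx hxW)
    exact fun v hv => ⟨hv.1, hv.2.2⟩

theorem isConforming_leaves_closureTree (h : IsRootMesh 𝒯₀) (hI : IsTree 𝒯₀ I) (hm : 2 ≤ m) :
    IsConforming (leaves 𝒯₀ (closureTree 𝒯₀ m I)) := by
  have hJ := h.isTree_closureTree hI (m := m) (by omega)
  have key : ∀ T ∈ leaves 𝒯₀ (closureTree 𝒯₀ m I), ∀ T' ∈ leaves 𝒯₀ (closureTree 𝒯₀ m I),
      T.level = T'.level + 1 →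
      T.verts ≠ T'.verts ∧ T.carrier ∩ T'.carrier = convexHull ℝ (T.verts ∩ T'.verts) := by
    intro T hT T' hT' hl
    rcases (mem_leaves.mp hT).1 with h0 | ⟨P, hP, hTP⟩
    · have := h.level_eq_zero T h0
      omega
    · obtain ⟨j, hj⟩ := hJ.exists_mem_uniformMesh P hP
      have h1 := hTP.level_eq
      rw [h.level_eq hj] at h1
      obtain rfl : j = T'.level := by omega
      exact h.conforming_of_level_succ hI hP hj hTP (h.mem_uniformMesh_level hJ hT')
        (mem_leaves.mp hT').2
  intro T hT T' hT' hne
  by_cases ht : T.Touches T'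
  · have h1 := h.level_le_of_mem_ball hI (by omega) (n := 1) (by omega) hT (mem_ball_one hT' ht)
    have h2 := h.level_le_of_mem_ball hI (by omega) (n := 1) (by omega) hT'
      (mem_ball_one hT ht.symm)
    rcases lt_trichotomy T.level T'.level with hl | hl | hl
    · obtain ⟨k1, k2⟩ := key T' hT' T hT (by omega)
      refine ⟨k1.symm, ?_⟩
      rw [Set.inter_comm, Set.inter_comm T.verts]
      exact k2
    · have hTk := h.mem_uniformMesh_level hJ hT
      have hTk' := h.mem_uniformMesh_level hJ hT'
      rw [← hl] at hTk'
      exact (h.uniformMesh T.level).conforming T hTk T' hTk' hne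
    · exact key T hT T' hT' (by omega)
  · refine ⟨fun hv => ht (touches_of_mem T.apex_mem_carrier
      (T'.verts_subset_carrier (hv ▸ T.apex_mem_verts))), inter_carrier_eq_of_subset ?_⟩
    exact fun x hx => absurd ⟨x, hx⟩ ht

end IsRootMesh

/-! ### Graded refinements of comparable cardinality -/

theorem exists_touches_of_mem_patch {𝒯 : Mesh} {S : Set Plane} {T : Elem} (hT : T ∈ patch 𝒯 S) :
    T ∈ 𝒯 ∧ ∃ R ∈ 𝒯, T.Touches R ∧ (R.carrier ∩ S).Nonempty := by
  obtain ⟨hT, x, hx, hxS⟩ := hT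
  have hx' := interior_subset hx
  simp only [Set.mem_iUnion] at hx'
  obtain ⟨R, ⟨hR, hTR⟩, hxR⟩ := hx'
  exact ⟨hT, R, hR, hTR, x, hxR, hxS⟩

/-- Each application of the patch operation costs at most two steps in the touching relation. -/
theorem extPatch_subset_ball {𝒯 : Mesh} (T : Elem) (n : ℕ) :
    ∀ T' ∈ extPatch 𝒯 T.carrier n, T' ∈ ball 𝒯 (2 * n) T := by
  induction n using extPatch.induct with
  | case1 => exact fun T' hT' => absurd hT' (Set.notMem_empty T')
  | case2 =>
    intro T' hT'
    obtain ⟨hT', R, hR, hTR, hRS⟩ := exists_touches_of_mem_patch hT'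
    exact mem_ball_succ.mpr ⟨R, mem_ball_one hR (Touches.symm hRS), hT', hTR.symm⟩
  | case3 n ih =>
    intro T' hT'
    obtain ⟨hT', R, hR, hTR, x, hxR, hx⟩ := exists_touches_of_mem_patch hT'
    simp only [Set.mem_iUnion] at hx
    obtain ⟨Q, hQ, hxQ⟩ := hx
    exact mem_ball_succ.mpr ⟨R, mem_ball_succ.mpr ⟨Q, ih Q hQ, hR, touches_of_mem hxQ hxR⟩,
      hT', hTR.symm⟩

/-- Every conforming refinement has a mildly graded refinement with a comparable number of
bisections. -/
theorem IsRootMesh.exists_gradedRefinement (h : IsRootMesh 𝒯₀) (D : ℕ) :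
    ∃ C : ℕ, ∀ 𝒯 ∈ refinements 𝒯₀, ∃ 𝒯' ∈ gradedRefinements 𝒯₀ D, 𝒯' ∈ refinements 𝒯 ∧
      ∀ n, 𝒯.card ≤ 𝒯₀.card + n → 𝒯'.card ≤ 𝒯₀.card + C * n := by
  let m := 4 * D + 2
  refine ⟨(3 * (4 * max 𝒯₀.card 2)) ^ (2 * (3 * m) + 1), fun 𝒯 h𝒯 => ?_⟩
  obtain ⟨I, hI, rfl⟩ := h.exists_tree h𝒯.1
  have hJ := h.isTree_closureTree hI (m := m) (by omega)
  have hconf := h.isConforming_leaves_closureTree hI (m := m) (by omega)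
  have hstep := h.reflTransGen_leaves hI hJ (h.subset_closureTree hI)
  refine ⟨leaves 𝒯₀ (closureTree 𝒯₀ m I), ⟨⟨h𝒯.1.trans hstep, hconf⟩, ?_⟩, ⟨hstep, hconf⟩, ?_⟩
  · intro T hT T' hT'
    have hball := extPatch_subset_ball T D T' hT'
    have h1 := h.level_le_of_mem_ball hI (by omega) (by omega) hT hball
    have h2 := h.level_le_of_mem_ball hI (by omega) (by omega) (mem_of_mem_ball hT hball)
      (ball_symm hT hball)
    rw [abs_le]
    omega
  · intro n hn
    rw [h.card_leaves hI] at hn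
    rw [h.card_leaves hJ]
    refine Nat.add_le_add_left ((h.card_closureTree_le hI m).trans ?_) _
    exact Nat.mul_le_mul_left _ (by omega)

/-! ### Quasi-monotonicity of the estimator and equality of the approximation classes -/

theorem estimator_nonneg (η : Mesh → Elem → ℝ) (𝒯 : Mesh) : 0 ≤ estimator η 𝒯 := Real.sqrt_nonneg _

theorem sum_sq_le_estimator_sq (η : Mesh → Elem → ℝ) {𝒯 S : Mesh} (hS : S ⊆ 𝒯) :
    ∑ T ∈ S, η 𝒯 T ^ 2 ≤ estimator η 𝒯 ^ 2 := by
  rw [estimator, Real.sq_sqrt (Finset.sum_nonneg fun _ _ => sq_nonneg _)]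
  exact Finset.sum_le_sum_of_subset_of_nonneg hS fun _ _ _ => sq_nonneg _

/-- Stability, reduction and discrete reliability imply that the estimator is monotone under
refinement up to a constant. -/
theorem exists_estimator_le {X : Type*} [NormedAddCommGroup X] {𝒯₀ : Mesh} {uh : Mesh → X}
    {η : Mesh → Elem → ℝ} (hstab : StabilityAxiom 𝒯₀ uh η) (hred : ReductionAxiom 𝒯₀ uh η)
    (hdlr : DiscreteReliabilityAxiom 𝒯₀ uh η) :
    ∃ C : ℝ, 0 < C ∧ ∀ 𝒯 ∈ refinements 𝒯₀, ∀ 𝒯' ∈ refinements 𝒯₀, 𝒯' ∈ refinements 𝒯 →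
      estimator η 𝒯' ≤ C * estimator η 𝒯 := by
  obtain ⟨Cs, hCs, hstab⟩ := hstab
  obtain ⟨q, Cr, -, hq1, hCr, hred⟩ := hred
  obtain ⟨Cd, Cref, hCd, -, hdlr⟩ := hdlr
  refine ⟨√((1 + Cs * Cd) ^ 2 + (1 + Cr * Cd ^ 2)), by positivity, ?_⟩
  intro 𝒯 h𝒯 𝒯' h𝒯' href
  have h0 := estimator_nonneg η 𝒯
  have hx2 : ‖uh 𝒯 - uh 𝒯'‖ ^ 2 ≤ Cd ^ 2 * estimator η 𝒯 ^ 2 := by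
    obtain ⟨R, hR, -, -, h⟩ := hdlr 𝒯 h𝒯 𝒯' h𝒯' href
    rw [norm_sub_rev]
    exact h.trans (mul_le_mul_of_nonneg_left (sum_sq_le_estimator_sq η hR) (sq_nonneg _))
  have hx : ‖uh 𝒯 - uh 𝒯'‖ ≤ Cd * estimator η 𝒯 :=
    le_of_sq_le_sq (by rw [mul_pow]; exact hx2) (by positivity)
  have h1 : ∑ T ∈ 𝒯 ∩ 𝒯', η 𝒯' T ^ 2 ≤ (1 + Cs * Cd) ^ 2 * estimator η 𝒯 ^ 2 := by
    have h := (abs_le.mp (hstab 𝒯 h𝒯 𝒯' h𝒯' href (𝒯 ∩ 𝒯') subset_rfl)).2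
    have h2 : √(∑ T ∈ 𝒯 ∩ 𝒯', η 𝒯 T ^ 2) ≤ estimator η 𝒯 :=
      Real.sqrt_le_sqrt (Finset.sum_le_sum_of_subset_of_nonneg Finset.inter_subset_left
        fun _ _ _ => sq_nonneg _)
    have h3 : √(∑ T ∈ 𝒯 ∩ 𝒯', η 𝒯' T ^ 2) ≤ (1 + Cs * Cd) * estimator η 𝒯 := by
      have := mul_le_mul_of_nonneg_left hx hCs.le
      linarith
    rw [← mul_pow, ← Real.sqrt_le_left (by positivity)]
    exact h3
  have h2 : ∑ T ∈ 𝒯' \ 𝒯, η 𝒯' T ^ 2 ≤ (1 + Cr * Cd ^ 2) * estimator η 𝒯 ^ 2 := by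
    have hS := sum_sq_le_estimator_sq η (Finset.sdiff_subset (s := 𝒯) (t := 𝒯'))
    have hS0 : 0 ≤ ∑ T ∈ 𝒯 \ 𝒯', η 𝒯 T ^ 2 := Finset.sum_nonneg fun _ _ => sq_nonneg _
    have h3 := mul_le_mul_of_nonneg_left hx2 hCr.le
    have h4 := mul_le_mul_of_nonneg_right hq1.le hS0
    linarith [hred 𝒯 h𝒯 𝒯' h𝒯' href]
  rw [estimator]
  refine Real.sqrt_le_iff.mpr ⟨by positivity, ?_⟩
  rw [mul_pow, Real.sq_sqrt (by positivity), ← Finset.sum_inter_add_sum_sdiff 𝒯' 𝒯,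
    Finset.inter_comm]
  linarith

theorem approxNorm_anti {𝕋 𝕋' : Set Mesh} (h : 𝕋' ⊆ 𝕋) (𝒯₀ : Mesh) (η : Mesh → Elem → ℝ) (s : ℝ) :
    approxNorm 𝕋 𝒯₀ η s ≤ approxNorm 𝕋' 𝒯₀ η s :=
  iSup_mono fun _ => biInf_mono fun _ h𝒯 => ⟨h h𝒯.1, h𝒯.2⟩

/-- If every mesh of `𝕋` can be replaced by a mesh of `𝕋'` with a comparable number of additional
elements and a comparable estimator, then the class with respect to `𝕋'` is at least as large. -/
theorem approxNorm_lt_top_of_comparable {𝕋 𝕋' : Set Mesh} {𝒯₀ : Mesh} {η : Mesh → Elem → ℝ} {s : ℝ}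
    (hs : 0 < s) (h₀ : 𝒯₀ ∈ 𝕋') {C : ℕ} {K : ℝ} (hK : 0 < K)
    (hcomp : ∀ 𝒯 ∈ 𝕋, ∃ 𝒯' ∈ 𝕋', estimator η 𝒯' ≤ K * estimator η 𝒯 ∧
      ∀ n, 𝒯.card ≤ 𝒯₀.card + n → 𝒯'.card ≤ 𝒯₀.card + C * n)
    (hfin : approxNorm 𝕋 𝒯₀ η s < ∞) : approxNorm 𝕋' 𝒯₀ η s < ∞ := by
  set A : ℝ := ((2 * (C + 1) : ℕ) : ℝ) ^ s with hA
  have hA0 : 0 < A := Real.rpow_pos_of_pos (by positivity) _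
  have hbound : approxNorm 𝕋' 𝒯₀ η s ≤ max (ENNReal.ofReal (A * estimator η 𝒯₀))
      (ENNReal.ofReal (A * K) * approxNorm 𝕋 𝒯₀ η s) := by
    refine iSup_le fun N => ?_
    -- The budget `N` in `𝕋'` is compared with the budget `N / (C + 1)` in `𝕋`.
    rcases Nat.eq_zero_or_pos (N / (C + 1)) with hn | hn
    · have hN : N < C + 1 := by
        rcases Nat.div_eq_zero_iff.mp hn with h | h
        · omega
        · exact h
      refine le_max_of_le_left ((iInf₂_le 𝒯₀ ⟨h₀, Nat.le_add_right _ _⟩).trans ?_)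
      refine ENNReal.ofReal_le_ofReal (mul_le_mul_of_nonneg_right ?_ (estimator_nonneg η 𝒯₀))
      exact Real.rpow_le_rpow (Nat.cast_nonneg _) (by exact_mod_cast (by omega)) hs.le
    · refine le_max_of_le_right ?_
      set n := N / (C + 1) with hndef
      have h1 : n * (C + 1) ≤ N := Nat.div_mul_le_self N (C + 1)
      have h2 : N ≤ 2 * (C + 1) * n := by
        have h3 := Nat.lt_div_mul_add (a := N) (Nat.succ_pos C)
        rw [Nat.succ_eq_add_one, ← hndef] at h3
        nlinarith
      have hpow : (N : ℝ) ^ s ≤ A * (n : ℝ) ^ s := by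
        rw [hA, ← Real.mul_rpow (Nat.cast_nonneg _) (Nat.cast_nonneg _)]
        exact Real.rpow_le_rpow (Nat.cast_nonneg _) (by exact_mod_cast h2) hs.le
      refine le_trans ?_ (mul_le_mul_right (le_iSup _ n) _)
      have hAK : ENNReal.ofReal (A * K) ≠ 0 := by
        rw [Ne, ENNReal.ofReal_eq_zero, not_le]
        positivity
      simp only [ENNReal.mul_iInf_of_ne hAK ENNReal.ofReal_ne_top]
      refine le_iInf₂ fun 𝒯 h𝒯 => ?_
      obtain ⟨𝒯', h𝒯', hη, hcard⟩ := hcomp 𝒯 h𝒯.1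
      have hN : C * n ≤ N := by nlinarith
      refine (iInf₂_le 𝒯' ⟨h𝒯', (hcard n h𝒯.2).trans (Nat.add_le_add_left hN _)⟩).trans ?_
      rw [← ENNReal.ofReal_mul (by positivity)]
      refine ENNReal.ofReal_le_ofReal ?_
      calc (N : ℝ) ^ s * estimator η 𝒯' ≤ (A * (n : ℝ) ^ s) * (K * estimator η 𝒯) :=
            mul_le_mul hpow hη (estimator_nonneg η 𝒯') (by positivity)
        _ = A * K * ((n : ℝ) ^ s * estimator η 𝒯) := by ring
  exact hbound.trans_lt
    (max_lt ENNReal.ofReal_lt_top (ENNReal.mul_lt_top ENNReal.ofReal_lt_top hfin))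

theorem IsInitialTriangulation.isRootMesh {Ω : Set Plane} {𝒯₀ : Mesh}
    (h : IsInitialTriangulation Ω 𝒯₀) (hmatch : HasMatchingRefEdges 𝒯₀) : IsRootMesh 𝒯₀ where
  nondegenerate := h.nondegenerate
  conforming := h.conforming
  matching := hmatch
  level_eq_zero := h.level_eq_zero

theorem IsRootMesh.mem_gradedRefinements {𝒯₀ : Mesh} (h : IsRootMesh 𝒯₀) (D : ℕ) :
    𝒯₀ ∈ gradedRefinements 𝒯₀ D := by
  refine ⟨⟨.refl, h.conforming⟩, fun T hT T' hT' => ?_⟩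
  rw [h.level_eq_zero T hT,
    h.level_eq_zero T' (mem_of_mem_ball hT (extPatch_subset_ball T D T' hT'))]
  norm_num

end AFEM

end

theorem lemma2p1
    {Ω : Set AFEM.Plane} {𝒯₀ : AFEM.Mesh}
    (h₀ : AFEM.IsInitialTriangulation Ω 𝒯₀) (hmatch : AFEM.HasMatchingRefEdges 𝒯₀)
    {D : ℕ} (hD : 1 ≤ D)
    {X : Type*} [NormedAddCommGroup X] [InnerProductSpace ℝ X] [CompleteSpace X]
    (a : X →L[ℝ] X →L[ℝ] ℝ) (ha : IsCoercive a)
    (V : AFEM.Mesh → ClosedSubmodule ℝ X)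
    (F : Set (X →L[ℝ] ℝ)) (η : (X →L[ℝ] ℝ) → AFEM.Mesh → AFEM.Elem → ℝ)
    (hA1 : ∀ f ∈ F, AFEM.StabilityAxiom 𝒯₀
      (fun 𝒯 => AFEM.galerkinSolution a ha f (V 𝒯)) (η f))
    (hA2 : ∀ f ∈ F, AFEM.ReductionAxiom 𝒯₀
      (fun 𝒯 => AFEM.galerkinSolution a ha f (V 𝒯)) (η f))
    (hA4 : ∀ f ∈ F, AFEM.DiscreteReliabilityAxiom 𝒯₀
      (fun 𝒯 => AFEM.galerkinSolution a ha f (V 𝒯)) (η f))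
    {s : ℝ} (hs : 0 < s) :
    AFEM.approxClass a F η (AFEM.refinements 𝒯₀) 𝒯₀ s =
      AFEM.approxClass a F η (AFEM.gradedRefinements 𝒯₀ D) 𝒯₀ s := by
  have hroot := h₀.isRootMesh hmatch
  obtain ⟨C, hC⟩ := hroot.exists_gradedRefinement D
  ext u
  constructor
  · rintro ⟨f, hf, hu, hfin⟩
    obtain ⟨K, hK, hmono⟩ := AFEM.exists_estimator_le (hA1 f hf) (hA2 f hf) (hA4 f hf)
    refine ⟨f, hf, hu, AFEM.approxNorm_lt_top_of_comparable hs (hroot.mem_gradedRefinements D)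
      (C := C) hK (fun 𝒯 h𝒯 => ?_) hfin⟩
    obtain ⟨𝒯', h𝒯', href, hcard⟩ := hC 𝒯 h𝒯
    exact ⟨𝒯', h𝒯', hmono 𝒯 h𝒯 𝒯' h𝒯'.1 href, hcard⟩
  · rintro ⟨f, hf, hu, hfin⟩
    exact ⟨f, hf, hu, (AFEM.approxNorm_anti (fun 𝒯 h𝒯 => h𝒯.1) _ _ _).trans_lt hfin⟩
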